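/- Let $\dot A$ be a densely defined symmetric operator with deficiency indices $(1,1)$ in a complex Hilbert space $\mathcal H$ (inner product $(\cdot,\cdot)$ linear in the first argument), let $A$ be a self-adjoint extension of $\dot A$, and let $\widehat A\neq(\widehat A)^*$ be a maximal dissipative extension of $\dot A$, that is, $\operatorname{Im}(\widehat A f,f)\ge 0$ for $f\in\operatorname{Dom}(\widehat A)$ and $\widehat A$ has no proper extension with this property. Let $g_\pm\in\operatorname{Ker}((\dot A)^*\mp iI)$, $\|g_\pm\|=1$, and $\kappa\in\mathbb C$, $|\kappa|<1$, be such that $$g_+-g_-\in\operatorname{Dom}(A)\quad\text{and}\quad g_+-\kappa g_-\in\operatorname{Dom}(\widehat A).$$ Write $\rho(\cdot)$ for the resolvent set. Let $M(z)=((zA+I)(A-zI)^{-1}g_+,g_+)$, $z\in\rho(A)$, be the Weyl–Titchmarsh function of the pair $(\dot A,A)$, and let $$s(z)=\frac{z-i}{z+i}\cdot\frac{(u,g_-)}{(u,g_+)},\qquad 0\ne u\in\operatorname{Ker}((\dot A)^*-zI),$$ be its Livšic function. Then: 1. The set $\rho(A)$ is symmetric about the real axis and $M(\bar z)=\overline{M(z)}$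 for $z\in\rho(A)$. For $z\in\rho(A)$ the value $s(z)\in\mathbb C\cup\{\infty\}$ does not depend on $u$, and $(u,g_+)\neq0$ if $\operatorname{Im}z>0$. 2. There is a Borel measure $\mu$ on $\mathbb R$ with $\mu(\mathbb R)=\infty$, $\int_{\mathbb R}\frac{d\mu(\lambda)}{1+\lambda^2}=1$ and $$M(z)=\int_{\mathbb R}\Big(\frac1{\lambda-z}-\frac{\lambda}{1+\lambda^2}\Big)\,d\mu(\lambda),\qquad \operatorname{Im}z>0.$$ 3. There are elements $0\ne g_z\in\operatorname{Ker}((\dot A)^*-zI)$, $z\in\rho(A)$, depending analytically on $z$, with $g_i=g_+$ and $g_{-i}=g_-$, such that for every measure $\mu$ as in 2 $$\|g_z\|=\Big(\int_{\mathbb R}\frac{d\mu(\lambda)}{|\lambda-z|^2}\Big)^{1/2},\qquad z\in\rho(A),$$ and such that for all $z\in\rho(\widehat A)\cap\rho(A)$ $$(\widehat A-zI)^{-1}=(A-zI)^{-1}-p(z)\,(\cdot\,,g_{\bar z})\,g_z,$$ where the expressions inverted below are nonzero and $$p(z)=\Big(M(z)+i\,\frac{\kappa+1}{\kappa-1}\Big)^{-1}=i\Big(\frac{s(z)+1}{s(z)-1}-\frac{\kappa+1}{\kappa-1}\Big)^{-1}.$$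 Here $s(z)\ne1$, and $\frac{s(z)+1}{s(z)-1}$ is read as $1$ at the poles of $s$, that is, if $z=-i$ or $(g_z,g_+)=0$ (there are none in the upper half-plane). -/

import Mathlib

open Complex MeasureTheory
open scoped InnerProductSpace ComplexConjugate ENNReal LinearPMap

namespace KreinResolvent

noncomputable section

variable {H : Type*} [NormedAddCommGroup H] [InnerProductSpace ℂ H]

/-- `T` is symmetric: `(T x, y) = (x, T y)` on its domain. -/
def IsSymmetric (T : H →ₗ.[ℂ] H) : Prop :=
  ∀ x y : T.domain, ⟪T x, (y : H)⟫_ℂ = ⟪(x : H), T y⟫_ℂ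

/-- `T` is dissipative: `Im (T x, x) ≥ 0` on its domain. Mathlib's inner product is linear in the
second variable, so that the form `(a, b)`, linear in the first one, is `⟪b, a⟫_ℂ`. -/
def IsDissipative (T : H →ₗ.[ℂ] H) : Prop :=
  ∀ x : T.domain, 0 ≤ (⟪(x : H), T x⟫_ℂ).im

/-- `T` is dissipative and has no proper dissipative extension. -/
def IsMaximalDissipative (T : H →ₗ.[ℂ] H) : Prop :=
  IsDissipative T ∧ ∀ T' : H →ₗ.[ℂ] H, IsDissipative T' → T ≤ T' → T' = T

/-- The subspace `Ker (T - z I)`. -/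
def eigenSubspace (T : H →ₗ.[ℂ] H) (z : ℂ) : Submodule ℂ H :=
  (LinearMap.ker (T.toFun - z • T.domain.subtype)).map T.domain.subtype

theorem mem_eigenSubspace {T : H →ₗ.[ℂ] H} {z : ℂ} {u : H} :
    u ∈ eigenSubspace T z ↔ ∃ h : u ∈ T.domain, T ⟨u, h⟩ = z • u := by
  simp [eigenSubspace, sub_eq_zero]

/-- The deficiency subspace `Ker (T* - z I)`. -/
def deficiencySubspace [CompleteSpace H] (T : H →ₗ.[ℂ] H) (z : ℂ) : Submodule ℂ H :=
  eigenSubspace T† z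

/-- `T` has deficiency indices `(1, 1)`. -/
def HasDeficiencyIndicesOneOne [CompleteSpace H] (T : H →ₗ.[ℂ] H) : Prop :=
  Module.finrank ℂ (deficiencySubspace T I) = 1 ∧
    Module.finrank ℂ (deficiencySubspace T (-I)) = 1

/-- `R` is a bounded, everywhere defined, two-sided inverse of `T - z I : Dom T → H`. -/
def IsResolventAt (T : H →ₗ.[ℂ] H) (z : ℂ) (R : H →L[ℂ] H) : Prop :=
  (∀ h : H, ∃ hd : R h ∈ T.domain, T ⟨R h, hd⟩ - z • R h = h) ∧
    ∀ x : T.domain, R (T x - z • (x : H)) = x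

/-- The resolvent set `ρ(T)`. -/
def rho (T : H →ₗ.[ℂ] H) : Set ℂ :=
  {z | ∃ R : H →L[ℂ] H, IsResolventAt T z R}

open Classical in
/-- The resolvent `(T - z I)⁻¹`, for `z ∈ ρ(T)` (and `0` for the other `z`). -/
def res (T : H →ₗ.[ℂ] H) (z : ℂ) : H →L[ℂ] H :=
  if h : ∃ R : H →L[ℂ] H, IsResolventAt T z R then h.choose else 0

open Classical in
/-- `T x`, for `x ∈ Dom T` (and `0` for the other `x`). -/
def app (T : H →ₗ.[ℂ] H) (x : H) : H :=
  if h : x ∈ T.domain then T ⟨x, h⟩ else 0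

/-- The Weyl-Titchmarsh function `M(z) = ((z A + I)(A - z I)⁻¹ g₊, g₊)`, for `z ∈ ρ(A)`. -/
def weylTitchmarsh (A : H →ₗ.[ℂ] H) (gp : H) (z : ℂ) : ℂ :=
  ⟪gp, z • app A (res A z gp) + res A z gp⟫_ℂ

/-- The expression `(z - i)/(z + i) · (u, g₋)/(u, g₊)`. -/
def livsicQuotient (gp gm : H) (z : ℂ) (u : H) : ℂ :=
  (z - I) / (z + I) * (⟪gm, u⟫_ℂ / ⟪gp, u⟫_ℂ)

/-- The Livšic function: `livsicQuotient` at some nonzero element `u` of `Ker (T* - z I)`. -/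
def livsic [CompleteSpace H] (T : H →ₗ.[ℂ] H) (gp gm : H) (z : ℂ) : ℂ :=
  livsicQuotient gp gm z
    (Classical.epsilon fun u : H => u ∈ deficiencySubspace T z ∧ u ≠ 0)

/-- `μ` is an infinite Borel measure with `∫ dμ(t)/(1 + t²) = 1` that represents `M` in the
upper half-plane. -/
structure IsHerglotzNevanlinna (M : ℂ → ℂ) (μ : Measure ℝ) : Prop where
  infinite : μ Set.univ = ∞
  normalized : ∫⁻ t : ℝ, (ENNReal.ofReal (1 + t ^ 2))⁻¹ ∂μ = 1
  represents : ∀ z : ℂ, 0 < z.im →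
    M z = ∫ t : ℝ, (1 / ((t : ℂ) - z) - (t : ℂ) / (1 + (t : ℂ) ^ 2)) ∂μ

/-- The function `p(z) = (M(z) + i (κ + 1)/(κ - 1))⁻¹`. -/
def kreinP (A : H →ₗ.[ℂ] H) (gp : H) (κ z : ℂ) : ℂ :=
  (weylTitchmarsh A gp z + I * ((κ + 1) / (κ - 1)))⁻¹

end

end KreinResolvent

open Filter Topology
open scoped CompactlySupported

namespace KreinResolvent


/-! ### Resolvents of unbounded operators -/

section Resolvent

variable {H : Type*} [NormedAddCommGroup H] [InnerProductSpace ℂ H]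

/-! Everything rests on the explicit field g_z = g₊ + (z - i)(A - z)⁻¹g₊ = (A - i)(A - z)⁻¹g₊. It
spans Ker(Ȧ* - z), and g₊ - g₋ ∈ Dom A forces g_{-i} = g₋. Three identities link it to M: (z +
i)(g_z, g₊) = M(z) + i, (z - i)(g_z, g₋) = M(z) - i, and Im M(z) = Im z ‖g_z‖². The first two make s
= (M - i)/(M + i), so that (s + 1)/(s - 1) = iM; the third turns a representation of M into the
formula for ‖g_z‖.

Krein's formula: both A and Â are restrictions of Ȧ* (for Â this follows from dissipativity alone),
so the two resolvents differ at h by c g_z. The domain of Â obeys one linear boundary condition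
(`boundary_condition`); inserting (Â - z)⁻¹h yields (M + i(κ + 1)/(κ - 1)) c = -(h, g_{z̄}), see
`exists_res_eq_add_smul`. Taking h = g_{z̄} shows that the factor is nonzero.

The measure comes from the unitary Cayley transform of A: continuous functional calculus and
Riesz-Markov give a finite measure σ on its spectrum (`exists_measure_cayley`). Since Im M(iy)/y =
‖g_{iy}‖² → 0, σ has no mass at w = 1, the image of t = ∞; moving σ to the line with density 1 + t²
gives μ. A finite μ would keep y‖g_{iy}‖ bounded and so put g₊ into Dom A, where it cannot lie. -/

theorem isResolventAt_res {T : H →ₗ.[ℂ] H} {z : ℂ} (hz : z ∈ rho T) :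
    IsResolventAt T z (res T z) := by
  have h : ∃ R : H →L[ℂ] H, IsResolventAt T z R := hz
  rw [res, dif_pos h]
  exact h.choose_spec

/-- Working with pairs in the graph, a subspace of `H × H`, avoids carrying domain proofs inside
terms and lets vectors be combined linearly. -/
theorem res_mem_graph {T : H →ₗ.[ℂ] H} {z : ℂ} (hz : z ∈ rho T) (h : H) :
    (res T z h, h + z • res T z h) ∈ T.graph := by
  obtain ⟨hd, e⟩ := (isResolventAt_res hz).1 h
  rw [LinearPMap.mem_graph_iff]
  exact ⟨⟨_, hd⟩, rfl, sub_eq_iff_eq_add.1 e⟩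

theorem res_of_mem_graph {T : H →ₗ.[ℂ] H} {z : ℂ} (hz : z ∈ rho T) {x y : H}
    (hxy : (x, y) ∈ T.graph) : res T z (y - z • x) = x := by
  rw [LinearPMap.mem_graph_iff] at hxy
  obtain ⟨x', rfl, rfl⟩ := hxy
  exact (isResolventAt_res hz).2 x'

theorem mem_rho_of_graph {T : H →ₗ.[ℂ] H} {z : ℂ} (R : H →L[ℂ] H)
    (h₁ : ∀ h, (R h, h + z • R h) ∈ T.graph)
    (h₂ : ∀ x y, (x, y) ∈ T.graph → R (y - z • x) = x) : z ∈ rho T := by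
  refine ⟨R, fun h => ?_, fun x => h₂ _ _ (T.mem_graph x)⟩
  have := h₁ h
  rw [LinearPMap.mem_graph_iff] at this
  obtain ⟨x, hx, e⟩ := this
  obtain ⟨x, hd⟩ := x
  dsimp only at hx e
  subst hx
  exact ⟨hd, by rw [e]; simp⟩

theorem res_eq_of_graph {T : H →ₗ.[ℂ] H} {z : ℂ} (hz : z ∈ rho T) {h x : H}
    (hx : (x, h + z • x) ∈ T.graph) : res T z h = x := by
  simpa using res_of_mem_graph hz hx

theorem app_of_mem_graph {T : H →ₗ.[ℂ] H} {x y : H} (hxy : (x, y) ∈ T.graph) : app T x = y := by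
  rw [LinearPMap.mem_graph_iff] at hxy
  obtain ⟨x', rfl, rfl⟩ := hxy
  simp [app]

/-- The first resolvent identity. -/
theorem res_sub_res {T : H →ₗ.[ℂ] H} {z w : ℂ} (hz : z ∈ rho T) (hw : w ∈ rho T) (h : H) :
    res T z h - res T w h = (z - w) • res T w (res T z h) := by
  have h1 := res_of_mem_graph hw (res_mem_graph hz h)
  have e : h + z • res T z h - w • res T z h = h + (z - w) • res T z h := by module
  rw [e, map_add, map_smul] at h1
  nth_rewrite 1 [← h1]
  abel

/-- The perturbed resolvent near a point of the resolvent set. -/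
theorem mem_rho_and_res_of_isUnit [CompleteSpace H] {T : H →ₗ.[ℂ] H} {w z : ℂ} (hw : w ∈ rho T)
    (hu : IsUnit (1 - (z - w) • res T w)) :
    z ∈ rho T ∧ res T z = res T w * Ring.inverse (1 - (z - w) • res T w) := by
  set R := res T w with hR
  set S := Ring.inverse (1 - (z - w) • R)
  have h1 : (1 - (z - w) • R) * S = 1 := Ring.mul_inverse_cancel _ hu
  have h2 : S * (1 - (z - w) • R) = 1 := Ring.inverse_mul_cancel _ hu
  have h1' : ∀ h, S h - (z - w) • R (S h) = h := fun h => by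
    simpa using DFunLike.congr_fun h1 h
  have hcomm : R * (1 - (z - w) • R) = (1 - (z - w) • R) * R := by
    simp [mul_sub, sub_mul]
  have hgr : ∀ h, ((R * S) h, h + z • (R * S) h) ∈ T.graph := fun h => by
    have := res_mem_graph hw (S h)
    have e : S h + w • R (S h) = h + z • R (S h) := by
      nth_rewrite 3 [← h1' h]
      module
    rwa [← hR, e] at this
  have hz : z ∈ rho T := by
    refine mem_rho_of_graph (R * S) hgr fun x y hxy => ?_
    have hx := res_of_mem_graph hw hxy
    -- `R * S` is visibly a right inverse of `T - z`; commuting the factors makes it a left inverse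
    -- too.
    have hRS : R * S = S * R := by
      calc R * S = (S * (1 - (z - w) • R)) * (R * S) := by rw [h2, one_mul]
        _ = S * ((1 - (z - w) • R) * R) * S := by simp only [mul_assoc]
        _ = S * R * ((1 - (z - w) • R) * S) := by rw [← hcomm]; simp only [mul_assoc]
        _ = S * R := by rw [h1, mul_one]
    rw [hRS, mul_apply_eq_comp]
    have e : R (y - z • x) = (1 - (z - w) • R) x := by
      have : y - z • x = (y - w • x) - (z - w) • x := by module
      rw [this, map_sub, hx, map_smul]
      simp
    rw [e, ← mul_apply_eq_comp, h2]
    rfl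
  exact ⟨hz, ContinuousLinearMap.ext fun h => res_eq_of_graph hz (hgr h)⟩

theorem eventually_isUnit_one_sub [CompleteSpace H] (R : H →L[ℂ] H) (w : ℂ) :
    ∀ᶠ z in 𝓝 w, IsUnit (1 - (z - w) • R) := by
  have hc : Continuous fun z : ℂ => 1 - (z - w) • R := by fun_prop
  have ho : IsOpen {z : ℂ | IsUnit (1 - (z - w) • R)} := Units.isOpen.preimage hc
  exact ho.mem_nhds (by simp)

theorem isOpen_rho [CompleteSpace H] (T : H →ₗ.[ℂ] H) : IsOpen (rho T) := by
  rw [isOpen_iff_mem_nhds]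
  intro w hw
  filter_upwards [eventually_isUnit_one_sub (res T w) w] with z hz
  exact (mem_rho_and_res_of_isUnit hw hz).1

theorem differentiableAt_res [CompleteSpace H] {T : H →ₗ.[ℂ] H} {w : ℂ} (hw : w ∈ rho T) :
    DifferentiableAt ℂ (res T) w := by
  have h1 : DifferentiableAt ℂ
      (fun z => res T w * Ring.inverse (1 - (z - w) • res T w)) w := by
    have h2 : DifferentiableAt ℂ (fun z : ℂ => 1 - (z - w) • res T w) w := by fun_prop
    have h3 : DifferentiableAt ℂ (Ring.inverse : (H →L[ℂ] H) → _) (1 - (w - w) • res T w) := by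
      have := differentiableAt_inverse (𝕜 := ℂ) (x := (1 - (w - w) • res T w)) (by simp)
      exact this
    exact (h3.comp w h2).const_mul (res T w)
  refine h1.congr_of_eventuallyEq ?_
  filter_upwards [eventually_isUnit_one_sub (res T w) w] with z hz
  exact (mem_rho_and_res_of_isUnit hw hz).2

end Resolvent

/-! ### Self-adjoint operators: symmetry and the resolvent set -/

section SelfAdjoint

variable {H : Type*} [NormedAddCommGroup H] [InnerProductSpace ℂ H] [CompleteSpace H]

theorem mem_graph_adjoint_iff {T : H →ₗ.[ℂ] H} (hT : Dense (T.domain : Set H)) {f w : H} :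
    (f, w) ∈ T†.graph ↔ ∀ x y, (x, y) ∈ T.graph → ⟪y, f⟫_ℂ = ⟪x, w⟫_ℂ := by
  constructor
  · intro h x y hxy
    rw [LinearPMap.mem_graph_iff] at h hxy
    obtain ⟨x', rfl, rfl⟩ := hxy
    obtain ⟨f', rfl, rfl⟩ := h
    exact (LinearPMap.adjoint_isFormalAdjoint hT).symm x' f'
  · intro h
    have h' : ∀ x : T.domain, ⟪w, (x : H)⟫_ℂ = ⟪f, T x⟫_ℂ := fun x => by
      rw [← inner_conj_symm, ← h _ _ (T.mem_graph x), inner_conj_symm]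
    have hd : f ∈ T†.domain := LinearPMap.mem_adjoint_domain_of_exists f ⟨w, h'⟩
    rw [LinearPMap.mem_graph_iff]
    exact ⟨⟨f, hd⟩, rfl, LinearPMap.adjoint_apply_eq hT _ h'⟩

theorem mem_deficiencySubspace_iff {T : H →ₗ.[ℂ] H} {z : ℂ} {u : H} :
    u ∈ deficiencySubspace T z ↔ (u, z • u) ∈ T†.graph := by
  rw [deficiencySubspace, mem_eigenSubspace, LinearPMap.mem_graph_iff]
  constructor
  · rintro ⟨h, e⟩
    exact ⟨⟨u, h⟩, rfl, e⟩
  · rintro ⟨⟨x, hx⟩, e, e'⟩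
    dsimp only at e e'
    subst e
    exact ⟨hx, e'⟩

variable {A : H →ₗ.[ℂ] H}

theorem mem_graph_iff_of_isSelfAdjoint (hA : IsSelfAdjoint A) {f w : H} :
    (f, w) ∈ A.graph ↔ ∀ x y, (x, y) ∈ A.graph → ⟪y, f⟫_ℂ = ⟪x, w⟫_ℂ := by
  have h := mem_graph_adjoint_iff hA.dense_domain (f := f) (w := w)
  rwa [LinearPMap.isSelfAdjoint_def.1 hA] at h

theorem inner_graph (hA : IsSelfAdjoint A) {x y x' y' : H} (h : (x, y) ∈ A.graph)
    (h' : (x', y') ∈ A.graph) :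
    ⟪y, x'⟫_ℂ = ⟪x, y'⟫_ℂ :=
  (mem_graph_iff_of_isSelfAdjoint hA).1 h' _ _ h

theorem inner_graph_im (hA : IsSelfAdjoint A) {x y : H} (h : (x, y) ∈ A.graph) :
    (⟪x, y⟫_ℂ).im = 0 := by
  have h1 := inner_graph hA h h
  rw [← inner_conj_symm] at h1
  exact Complex.conj_eq_iff_im.1 h1

/-- Pythagoras: `(y - Re z • x, x)` is real, so the cross term with `i Im z • x` has zero real part.
-/
theorem norm_sub_smul_sq (hA : IsSelfAdjoint A) {x y : H} (h : (x, y) ∈ A.graph) (z : ℂ) :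
    ‖y - z • x‖ ^ 2 = ‖y - (z.re : ℂ) • x‖ ^ 2 + z.im ^ 2 * ‖x‖ ^ 2 := by
  have e : y - z • x = (y - (z.re : ℂ) • x) - (z.im * I : ℂ) • x := by
    nth_rewrite 1 [← Complex.re_add_im z]; module
  have hre : RCLike.re ⟪y - (z.re : ℂ) • x, (z.im * I : ℂ) • x⟫_ℂ = 0 := by
    have h1 := inner_graph_im hA h
    have h2 := congrArg Complex.im (inner_conj_symm (𝕜 := ℂ) y x)
    rw [Complex.conj_im, h1] at h2
    rw [inner_smul_right, inner_sub_left, inner_smul_left, inner_self_eq_norm_sq_to_K]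
    simp [Complex.mul_re, Complex.mul_im, ← h2, ← Complex.ofReal_pow]
  rw [e, @norm_sub_sq ℂ, hre, norm_smul]
  simp [mul_pow]

theorem abs_im_mul_norm_le (hA : IsSelfAdjoint A) {x y : H} (h : (x, y) ∈ A.graph) (z : ℂ) :
    |z.im| * ‖x‖ ≤ ‖y - z • x‖ := by
  refine abs_le_of_sq_le_sq' ?_ (norm_nonneg _) |>.2
  rw [norm_sub_smul_sq hA h, mul_pow, sq_abs]
  nlinarith [sq_nonneg ‖y - (z.re : ℂ) • x‖]

/-- The Hilbert space adjoint of the resolvent at `z` inverts `A - z̄`. -/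
theorem conj_mem_rho (hA : IsSelfAdjoint A) {z : ℂ} (hz : z ∈ rho A) : conj z ∈ rho A := by
  refine mem_rho_of_graph (res A z).adjoint (fun h => ?_) fun x y hxy => ?_
  · rw [mem_graph_iff_of_isSelfAdjoint hA]
    intro x y hxy
    have h1 := res_of_mem_graph hz hxy
    have h2 : ⟪y - z • x, (res A z).adjoint h⟫_ℂ = ⟪x, h⟫_ℂ := by
      rw [ContinuousLinearMap.adjoint_inner_right, h1]
    rw [inner_sub_left, inner_smul_left] at h2
    rw [inner_add_right, inner_smul_right, ← h2]
    ring
  · refine ext_inner_left ℂ fun v => ?_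
    rw [ContinuousLinearMap.adjoint_inner_right]
    have h1 := inner_graph hA (res_mem_graph hz v) hxy
    rw [inner_add_left, inner_smul_left] at h1
    rw [inner_sub_right, inner_smul_right, ← h1]
    ring

theorem inner_res_left (hA : IsSelfAdjoint A) {z : ℂ} (hz : z ∈ rho A) (x y : H) :
    ⟪res A z x, y⟫_ℂ = ⟪x, res A (conj z) y⟫_ℂ := by
  have h1 := inner_graph hA (res_mem_graph hz x) (res_mem_graph (conj_mem_rho hA hz) y)
  rw [inner_add_left, inner_smul_left, inner_add_right, inner_smul_right] at h1
  exact (add_right_cancel h1).symm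

/-- `A - z` is bounded below by `|Im z|`, hence injective; with the closed graph of `A` its range is
closed. A vector orthogonal to the range is an eigenvector for `z̄`, which the same bound rules out.
-/
theorem mem_rho_of_im_ne_zero (hA : IsSelfAdjoint A) {z : ℂ} (hz : z.im ≠ 0) : z ∈ rho A := by
  set F : A.domain →ₗ[ℂ] H := A.toFun - z • A.domain.subtype with hF
  have hFg : ∀ x y, (x, y) ∈ A.graph → y - z • x ∈ LinearMap.range F := fun x y h => by
    rw [LinearPMap.mem_graph_iff] at h
    obtain ⟨x', rfl, rfl⟩ := h
    exact ⟨x', rfl⟩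
  have hbd : ∀ x : A.domain, |z.im| * ‖(x : H)‖ ≤ ‖F x‖ := fun x =>
    abs_im_mul_norm_le hA (A.mem_graph x) z
  have hinj : Function.Injective F := by
    rw [← LinearMap.ker_eq_bot, LinearMap.ker_eq_bot']
    intro x hx
    have := hbd x
    rw [hx, norm_zero] at this
    have h0 : ‖(x : H)‖ ≤ 0 := nonpos_of_mul_nonpos_right this (abs_pos.2 hz)
    exact Subtype.ext (norm_le_zero_iff.1 h0)
  have hclosed : IsClosed (LinearMap.range F : Set H) := by
    have hg : IsClosed (A.graph : Set (H × H)) := hA.isClosed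
    have : CompleteSpace A.graph := hg.completeSpace_coe
    let G : A.graph →L[ℂ] H :=
      (ContinuousLinearMap.snd ℂ H H - z • ContinuousLinearMap.fst ℂ H H).comp A.graph.subtypeL
    have hanti : ∃ K, AntilipschitzWith K G := by
      have hz' := abs_pos.2 hz
      refine ⟨⟨1 + (1 + ‖z‖) * |z.im|⁻¹, by positivity⟩, G.antilipschitz_of_bound ?_⟩
      rintro ⟨⟨x, y⟩, h⟩
      have h1 : ‖x‖ ≤ |z.im|⁻¹ * ‖y - z • x‖ := by
        rw [inv_mul_eq_div, le_div_iff₀' hz']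
        exact abs_im_mul_norm_le hA h z
      have h2 : ‖y‖ ≤ ‖y - z • x‖ + ‖z‖ * ‖x‖ := by
        calc ‖y‖ = ‖(y - z • x) + z • x‖ := by rw [sub_add_cancel]
          _ ≤ _ := (norm_add_le _ _).trans_eq (by rw [norm_smul])
      change max ‖x‖ ‖y‖ ≤ (1 + (1 + ‖z‖) * |z.im|⁻¹) * ‖y - z • x‖
      have h3 := mul_le_mul_of_nonneg_left h1 (norm_nonneg z)
      have h4 := norm_nonneg (y - z • x)
      have h5 : 0 ≤ ‖z‖ * (|z.im|⁻¹ * ‖y - z • x‖) := by positivity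
      have h6 : 0 ≤ |z.im|⁻¹ * ‖y - z • x‖ := by positivity
      refine max_le ?_ ?_ <;> linarith
    have hr : (LinearMap.range F : Set H) = Set.range G := by
      ext v
      constructor
      · rintro ⟨x, rfl⟩
        exact ⟨⟨_, A.mem_graph x⟩, rfl⟩
      · rintro ⟨⟨⟨x, y⟩, h⟩, rfl⟩
        exact hFg x y h
    rw [hr]
    obtain ⟨K, hK⟩ := hanti
    exact hK.isClosed_range G.uniformContinuous
  have htop : LinearMap.range F = ⊤ := by
    have : CompleteSpace (LinearMap.range F) := hclosed.completeSpace_coe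
    rw [← Submodule.orthogonal_eq_bot_iff, Submodule.eq_bot_iff]
    intro v hv
    have hv' : (v, conj z • v) ∈ A.graph := by
      rw [mem_graph_iff_of_isSelfAdjoint hA]
      intro x y hxy
      have := hv _ (hFg x y hxy)
      rw [inner_sub_left, inner_smul_left, sub_eq_zero] at this
      rw [this, inner_smul_right]
    have := abs_im_mul_norm_le hA hv' (conj z)
    rw [sub_self, norm_zero, conj_im, abs_neg] at this
    exact norm_le_zero_iff.1 (nonpos_of_mul_nonpos_right this (abs_pos.2 hz))
  let e := LinearEquiv.ofBijective F ⟨hinj, LinearMap.range_eq_top.1 htop⟩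
  have he : ∀ h, F (e.symm h) = h := fun h => e.apply_symm_apply h
  let R : H →L[ℂ] H := (A.domain.subtype.comp (e.symm : H →ₗ[ℂ] A.domain)).mkContinuous |z.im|⁻¹
    fun h => by
      have := hbd (e.symm h)
      rw [he] at this
      rw [inv_mul_eq_div, le_div_iff₀' (abs_pos.2 hz)]
      exact this
  refine mem_rho_of_graph R (fun h => ?_) fun x y hxy => ?_
  · have h1 := A.mem_graph (e.symm h)
    have h2 : A (e.symm h) = h + z • ((e.symm h : A.domain) : H) := by
      have := he h
      nth_rewrite 2 [← this]
      simp [hF]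
    rw [h2] at h1
    exact h1
  · rw [LinearPMap.mem_graph_iff] at hxy
    obtain ⟨x', rfl, rfl⟩ := hxy
    change ((e.symm (e x') : A.domain) : H) = x'
    rw [e.symm_apply_apply]

end SelfAdjoint


/-! ### The deficiency field and its pairings with g₊ and g₋ -/

section DeficiencyField

variable {H : Type*} [NormedAddCommGroup H] [InnerProductSpace ℂ H]

/-- The family `g_z = (A - i I)(A - z I)⁻¹ g₊`. -/
noncomputable def deficiencyField (A : H →ₗ.[ℂ] H) (gp : H) (z : ℂ) : H :=
  gp + (z - I) • res A z gp

theorem deficiencyField_I (A : H →ₗ.[ℂ] H) (gp : H) : deficiencyField A gp I = gp := by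
  simp [deficiencyField]

theorem weylTitchmarsh_eq {A : H →ₗ.[ℂ] H} {gp : H} (hgp1 : ‖gp‖ = 1) {z : ℂ} (hz : z ∈ rho A) :
    weylTitchmarsh A gp z = z + (1 + z ^ 2) * ⟪gp, res A z gp⟫_ℂ := by
  rw [weylTitchmarsh, app_of_mem_graph (res_mem_graph hz gp), inner_add_right, inner_smul_right,
    inner_add_right, inner_smul_right, inner_self_eq_norm_sq_to_K, hgp1]
  simp
  ring

theorem add_I_mul_inner_deficiencyField {A : H →ₗ.[ℂ] H} {gp : H} (hgp1 : ‖gp‖ = 1) {z : ℂ}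
    (hz : z ∈ rho A) :
    (z + I) * ⟪gp, deficiencyField A gp z⟫_ℂ = weylTitchmarsh A gp z + I := by
  rw [weylTitchmarsh_eq hgp1 hz, deficiencyField, inner_add_right, inner_smul_right,
    inner_self_eq_norm_sq_to_K, hgp1]
  simp only [coe_algebraMap, ofReal_one]
  linear_combination -(⟪gp, res A z gp⟫_ℂ) * I_sq

theorem deficiencyField_ne_zero {A : H →ₗ.[ℂ] H} {gp : H} (hgpA : gp ∉ A.domain) {z : ℂ}
    (hz : z ∈ rho A) :
    deficiencyField A gp z ≠ 0 := by
  intro h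
  have h1 : gp = (-(z - I)) • res A z gp := by
    rw [deficiencyField] at h
    rw [neg_smul]
    exact eq_neg_of_add_eq_zero_left h
  refine hgpA ?_
  rw [h1]
  exact A.domain.smul_mem _ (LinearPMap.mem_domain_of_mem_graph (res_mem_graph hz gp))

theorem livsicQuotient_smul {c : ℂ} (hc : c ≠ 0) (gp gm : H) (z : ℂ) (u : H) :
    livsicQuotient gp gm z (c • u) = livsicQuotient gp gm z u := by
  rw [livsicQuotient, livsicQuotient, inner_smul_right, inner_smul_right,
    mul_div_mul_left _ _ hc]

theorem analyticOnNhd_deficiencyField [CompleteSpace H] (A : H →ₗ.[ℂ] H) (gp : H) :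
    AnalyticOnNhd ℂ (deficiencyField A gp) (rho A) := by
  refine DifferentiableOn.analyticOnNhd (fun z hz => ?_) (isOpen_rho A)
  have h := (differentiableAt_res hz).clm_apply (differentiableAt_const gp)
  refine DifferentiableAt.differentiableWithinAt ?_
  unfold deficiencyField
  fun_prop

variable [CompleteSpace H] {A : H →ₗ.[ℂ] H} {gp gm : H}

theorem weylTitchmarsh_conj (hA : IsSelfAdjoint A) (hgp1 : ‖gp‖ = 1) {z : ℂ} (hz : z ∈ rho A) :
    weylTitchmarsh A gp (conj z) = conj (weylTitchmarsh A gp z) := by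
  rw [weylTitchmarsh_eq hgp1 hz, weylTitchmarsh_eq hgp1 (conj_mem_rho hA hz),
    ← inner_res_left hA hz, ← inner_conj_symm]
  simp

/-- The link between norms of `g_z` and the measure, and the source of all positivity of `M`. It
reduces to `Im (R(z)g₊, g₊) = Im z ‖R(z)g₊‖²`. -/
theorem im_weylTitchmarsh (hA : IsSelfAdjoint A) (hgp1 : ‖gp‖ = 1) {z : ℂ} (hz : z ∈ rho A) :
    (weylTitchmarsh A gp z).im = z.im * ‖deficiencyField A gp z‖ ^ 2 := by
  have h1 := inner_graph_im hA (res_mem_graph hz gp)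
  rw [inner_add_right, inner_smul_right, inner_self_eq_norm_sq_to_K, ← inner_conj_symm] at h1
  have h2 : (⟪gp, res A z gp⟫_ℂ).im = z.im * ‖res A z gp‖ ^ 2 := by
    simp only [coe_algebraMap, add_im, conj_im, mul_im, ← ofReal_pow, ofReal_im, ofReal_re] at h1
    linarith
  rw [weylTitchmarsh_eq hgp1 hz, deficiencyField, @norm_add_sq ℂ, norm_smul, mul_pow,
    inner_smul_right, hgp1, Complex.sq_norm, normSq_apply]
  simp only [add_im, mul_im, RCLike.re_to_complex, mul_re, add_re, sub_re, sub_im, I_re, I_im,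
    one_re, one_im, pow_two, sub_zero]
  rw [pow_two] at h2
  linear_combination ((z.re) ^ 2 + (z.im - 1) ^ 2) * h2

theorem deficiencyField_neg_I (hA : IsSelfAdjoint A)
    (hg : (gp - gm, I • gp + I • gm) ∈ A.graph) : deficiencyField A gp (-I) = gm := by
  have h := res_of_mem_graph (z := -I) (mem_rho_of_im_ne_zero hA (by simp)) hg
  have e : I • gp + I • gm - (-I) • (gp - gm) = (2 * I) • gp := by module
  rw [e, map_smul] at h
  have e' : (-I - I) • res A (-I) gp = -((2 * I) • res A (-I) gp) := by module
  rw [deficiencyField, e', h]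
  abel

/-- Writing `g₋ = g_{-i}` turns the pairing into one with the product `R(i)R(z)`, which the
resolvent identity removes. -/
theorem sub_I_mul_inner_deficiencyField (hA : IsSelfAdjoint A) (hgp1 : ‖gp‖ = 1)
    (hg : (gp - gm, I • gp + I • gm) ∈ A.graph) {z : ℂ} (hz : z ∈ rho A) :
    (z - I) * ⟪gm, deficiencyField A gp z⟫_ℂ = weylTitchmarsh A gp z - I := by
  have hI : -I ∈ rho A := mem_rho_of_im_ne_zero hA (by simp)
  have hI' : I ∈ rho A := mem_rho_of_im_ne_zero hA (by simp)
  have h2 := congrArg (fun v => ⟪gp, v⟫_ℂ) (res_sub_res hz hI' gp)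
  simp only [inner_sub_right, inner_smul_right] at h2
  rw [← deficiencyField_neg_I hA hg, weylTitchmarsh_eq hgp1 hz, deficiencyField, deficiencyField]
  simp only [inner_add_right, inner_smul_right, inner_add_left, inner_smul_left,
    inner_res_left hA hI, inner_self_eq_norm_sq_to_K, hgp1, map_neg, map_sub, conj_I, neg_neg]
  simp only [coe_algebraMap, ofReal_one]
  linear_combination (2 * I * (I - z)) * h2 - (⟪gp, res A z gp⟫_ℂ) * I_sq

end DeficiencyField

/-! ### Extensions inside the adjoint and the boundary condition -/

section Extension

variable {H : Type*} [NormedAddCommGroup H] [InnerProductSpace ℂ H] [CompleteSpace H]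
  {Adot A Ahat : H →ₗ.[ℂ] H} {gp gm : H}

theorem graph_le_graph_adjoint (hdense : Dense (Adot.domain : Set H)) (hA : IsSelfAdjoint A)
    (hAext : Adot ≤ A) : A.graph ≤ Adot†.graph := by
  rintro ⟨f, w⟩ h
  rw [mem_graph_adjoint_iff hdense]
  exact fun x y hxy => inner_graph hA (LinearPMap.le_graph_of_le hAext hxy) h

theorem deficiencyField_mem (hle : A.graph ≤ Adot†.graph) (hgp : gp ∈ deficiencySubspace Adot I)
    {z : ℂ} (hz : z ∈ rho A) : deficiencyField A gp z ∈ deficiencySubspace Adot z := by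
  rw [mem_deficiencySubspace_iff] at hgp ⊢
  have h := add_mem hgp (Submodule.smul_mem _ (z - I) (hle (res_mem_graph hz gp)))
  convert h using 1
  ext
  · simp [deficiencyField]
  · simp only [deficiencyField, Prod.smul_mk, Prod.mk_add_mk]
    module

theorem notMem_domain (hA : IsSelfAdjoint A) (hle : A.graph ≤ Adot†.graph)
    (hgp : gp ∈ deficiencySubspace Adot I) (hgp0 : gp ≠ 0) : gp ∉ A.domain := by
  intro h
  rw [mem_deficiencySubspace_iff] at hgp
  have h1 := A.mem_graph ⟨gp, h⟩
  have h2 := LinearPMap.mem_graph_snd_inj _ (hle h1) hgp rfl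
  rw [h2] at h1
  have h3 := abs_im_mul_norm_le hA h1 I
  simp only [I_im, abs_one, one_mul, sub_self, norm_zero, norm_le_zero_iff] at h3
  exact hgp0 h3

/-- The map `1 + (i - z)R(i)` carries the deficiency subspace at `z` into the one-dimensional one at
`i`, and `1 + (z - i)R(z)` undoes it. -/
theorem exists_eq_smul_deficiencyField (hA : IsSelfAdjoint A) (hle : A.graph ≤ Adot†.graph)
    (hdim : Module.finrank ℂ (deficiencySubspace Adot I) = 1)
    (hgp : gp ∈ deficiencySubspace Adot I) (hgp0 : gp ≠ 0) {z : ℂ} (hz : z ∈ rho A) {u : H}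
    (hu : u ∈ deficiencySubspace Adot z) : ∃ c : ℂ, u = c • deficiencyField A gp z := by
  have hI : I ∈ rho A := mem_rho_of_im_ne_zero hA (by simp)
  have hv : u + (I - z) • res A I u ∈ deficiencySubspace Adot I := by
    rw [mem_deficiencySubspace_iff] at hu ⊢
    have h := add_mem hu (Submodule.smul_mem _ (I - z) (hle (res_mem_graph hI u)))
    convert h using 1
    ext
    · simp
    · simp only [Prod.smul_mk, Prod.mk_add_mk]
      module
  obtain ⟨c, hc⟩ := (finrank_eq_one_iff_of_nonzero' (⟨gp, hgp⟩ : deficiencySubspace Adot I)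
    (by simpa using hgp0)).1 hdim ⟨_, hv⟩
  have hc' : c • gp = u + (I - z) • res A I u := congrArg Subtype.val hc
  have h1 := res_sub_res hI hz u
  have h2 : res A z (u + (I - z) • res A I u) = res A I u := by
    rw [map_add, map_smul, ← h1]; abel
  refine ⟨c, ?_⟩
  have h3 : c • deficiencyField A gp z = c • gp + (z - I) • res A z (c • gp) := by
    rw [deficiencyField, map_smul]; module
  rw [h3, hc', h2]
  module

/-- A dissipative extension of a symmetric operator is contained in its adjoint. -/
theorem graph_le_graph_adjoint_of_isDissipative (hdense : Dense (Adot.domain : Set H))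
    (hsymm : IsSymmetric Adot) (hdiss : IsDissipative Ahat) (hext : Adot ≤ Ahat) :
    Ahat.graph ≤ Adot†.graph := by
  rintro ⟨f, w⟩ hf
  rw [mem_graph_adjoint_iff hdense]
  intro x y hxy
  have hdiss' : ∀ a b, (a, b) ∈ Ahat.graph → 0 ≤ (⟪a, b⟫_ℂ).im := by
    intro a b hab
    rw [LinearPMap.mem_graph_iff] at hab
    obtain ⟨a', rfl, rfl⟩ := hab
    exact hdiss a'
  have hx0 : (⟪x, y⟫_ℂ).im = 0 := by
    rw [LinearPMap.mem_graph_iff] at hxy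
    obtain ⟨a', rfl, rfl⟩ := hxy
    have := hsymm a' a'
    rw [← inner_conj_symm] at this
    exact Complex.conj_eq_iff_im.1 this
  have hxy' := LinearPMap.le_graph_of_le hext hxy
  set d := ⟪x, w⟫_ℂ - ⟪y, f⟫_ℂ with hd
  -- Dissipativity at `t x + f`: symmetry kills the term quadratic in `t`, leaving a real-affine
  -- function of `t` that is bounded below, so its slope vanishes.
  have key : ∀ t : ℂ, 0 ≤ (conj t * d).im + (⟪f, w⟫_ℂ).im := by
    intro t
    have h := add_mem (Submodule.smul_mem _ t hxy') hf
    simp only [Prod.smul_mk, Prod.mk_add_mk] at h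
    replace h := hdiss' _ _ h
    simp only [inner_add_left, inner_add_right, inner_smul_left,
      inner_smul_right] at h
    have h1 : ⟪f, y⟫_ℂ = conj ⟪y, f⟫_ℂ := (inner_conj_symm _ _).symm
    rw [h1] at h
    simp only [hd, mul_im, add_im, mul_re, add_re, conj_re, conj_im, sub_re, sub_im, hx0] at h ⊢
    linarith
  have hd0 : d = 0 := by
    clear_value d
    by_contra hne
    have hpos : 0 < normSq d := normSq_pos.2 hne
    -- This `t` is scaled to make the lower bound equal to -1.
    have h := key (I * ((((⟪f, w⟫_ℂ).im + 1) / normSq d : ℝ) : ℂ) * d)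
    have e : conj (I * ((((⟪f, w⟫_ℂ).im + 1) / normSq d : ℝ) : ℂ) * d) * d
        = -(I * (((⟪f, w⟫_ℂ).im + 1 : ℝ) : ℂ)) := by
      have h2 : conj d * d = (normSq d : ℂ) := (normSq_eq_conj_mul_self).symm
      have h3 : (normSq d : ℂ) ≠ 0 := by exact_mod_cast hpos.ne'
      rw [map_mul, map_mul, mul_assoc, h2, conj_I, conj_ofReal]
      push_cast
      field_simp
    rw [e] at h
    simp only [neg_im, mul_im, I_re, I_im, ofReal_re, ofReal_im] at h
    linarith
  exact (sub_eq_zero.1 hd0).symm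

/-- The functional vanishes on `g₊ - κ g₋`. Modulo that vector, an element of `Dom Â` is `x + c g₋`
with `x ∈ Dom A`, and dissipativity forces `c = 0`. -/
theorem boundary_condition (hA : IsSelfAdjoint A) (hle : A.graph ≤ Adot†.graph)
    (hlehat : Ahat.graph ≤ Adot†.graph) (hdiss : IsDissipative Ahat)
    (hdim : Module.finrank ℂ (deficiencySubspace Adot I) = 1)
    (hgp : gp ∈ deficiencySubspace Adot I) (hgm : gm ∈ deficiencySubspace Adot (-I))
    (hgp1 : ‖gp‖ = 1) (hgm1 : ‖gm‖ = 1)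
    (hg : (gp - gm, I • gp + I • gm) ∈ A.graph)
    {κ : ℂ} (hgAhat : gp - κ • gm ∈ Ahat.domain) {f w : H} (hf : (f, w) ∈ Ahat.graph) :
    ⟪gm, I • f - w⟫_ℂ + κ * ⟪gp, w + I • f⟫_ℂ = 0 := by
  have hgp0 : gp ≠ 0 := by rintro rfl; simp at hgp1
  have hpp : ⟪gp, gp⟫_ℂ = 1 := by rw [inner_self_eq_norm_sq_to_K, hgp1]; simp
  have hmm : ⟪gm, gm⟫_ℂ = 1 := by rw [inner_self_eq_norm_sq_to_K, hgm1]; simp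
  have hI : -I ∈ rho A := mem_rho_of_im_ne_zero hA (by simp)
  have hgκ : (gp - κ • gm, I • gp + (κ * I) • gm) ∈ Ahat.graph := by
    have h1 := Ahat.mem_graph ⟨_, hgAhat⟩
    have h2 := sub_mem (mem_deficiencySubspace_iff.1 hgp)
      (Submodule.smul_mem _ κ (mem_deficiencySubspace_iff.1 hgm))
    have h3 := LinearPMap.mem_graph_snd_inj _ (hlehat h1) h2 rfl
    rw [h3] at h1
    convert h1 using 2
    simp only [Prod.smul_mk]
    module
  -- `Ȧ* + i` sends `g₊ - κ g₋` to `2i g₊`; hence subtracting `a` times this vector kills the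
  -- pairing with `g₊`.
  obtain ⟨a, ha⟩ : ∃ a : ℂ, ⟪gp, w + I • f⟫_ℂ = 2 * I * a :=
    ⟨⟪gp, w + I • f⟫_ℂ / (2 * I), by field_simp⟩
  have hf' := sub_mem hf (Submodule.smul_mem _ a hgκ)
  simp only [Prod.smul_mk, Prod.mk_sub_mk] at hf'
  obtain ⟨f', ef⟩ : ∃ f', f' = f - a • (gp - κ • gm) := ⟨_, rfl⟩
  obtain ⟨w', ew⟩ : ∃ w', w' = w - a • (I • gp + (κ * I) • gm) := ⟨_, rfl⟩
  rw [← ef, ← ew] at hf'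
  have ha' : ⟪gp, w' + I • f'⟫_ℂ = 0 := by
    have : w' + I • f' = (w + I • f) - (2 * I * a) • gp := by rw [ef, ew]; module
    rw [this, inner_sub_right, inner_smul_right, ha, hpp]
    ring
  have hx := res_mem_graph hI (w' + I • f')
  obtain ⟨x, ex⟩ : ∃ x, x = res A (-I) (w' + I • f') := ⟨_, rfl⟩
  obtain ⟨y, ey⟩ : ∃ y, y = w' + I • f' + -I • x := ⟨_, rfl⟩
  rw [← ex, ← ey] at hx
  have hd : f' - x ∈ deficiencySubspace Adot (-I) := by
    rw [mem_deficiencySubspace_iff]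
    have h := sub_mem (hlehat hf') (hle hx)
    convert h using 1
    simp only [Prod.mk_sub_mk, ey]
    congr 1
    module
  obtain ⟨c, hc⟩ := exists_eq_smul_deficiencyField hA hle hdim hgp hgp0 hI hd
  rw [deficiencyField_neg_I hA hg] at hc
  have hf'x : f' = x + c • gm := by rw [← hc]; abel
  have hw'y : w' = y + (-I * c) • gm := by
    rw [ey, mul_smul, ← hc]; module
  have h1 : ⟪gp, y⟫_ℂ + I * ⟪gp, x⟫_ℂ = 0 := by
    have e : w' + I • f' = y + I • x := by rw [ey]; module
    rw [← ha', e, inner_add_right, inner_smul_right]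
  have h2 : ⟪gm, y⟫_ℂ = I * ⟪gm, x⟫_ℂ := by
    have h := inner_graph hA hg hx
    simp only [inner_add_left, inner_smul_left, inner_sub_left, conj_I] at h
    linear_combination h1 + h
  -- The terms in `x` and the cross terms are real, so `Im (Â f', f') = -|c|²`.
  have hc0 : c = 0 := by
    have h0 : 0 ≤ (⟪f', w'⟫_ℂ).im := by
      rw [LinearPMap.mem_graph_iff] at hf'
      obtain ⟨a', e1, e2⟩ := hf'
      dsimp only at e1 e2
      rw [← e1, ← e2]
      exact hdiss a'
    have h3 : ⟪x, gm⟫_ℂ = conj ⟪gm, x⟫_ℂ := (inner_conj_symm _ _).symm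
    have h4 := inner_graph_im hA hx
    rw [hf'x, hw'y] at h0
    simp only [inner_add_left, inner_add_right, inner_smul_left, inner_smul_right, h2, h3, hmm]
      at h0
    simp only [add_im, add_re, mul_im, mul_re, neg_re, neg_im, conj_re, conj_im, I_re, I_im, one_re,
      one_im, h4] at h0
    have h5 : normSq c ≤ 0 := by rw [normSq_apply]; linarith
    exact normSq_eq_zero.1 (le_antisymm h5 (normSq_nonneg c))
  have h6 : ⟪gm, I • f' - w'⟫_ℂ = 0 := by
    rw [hf'x, hw'y, hc0]
    simp [h2]
  have h7 : I • f - w = (I • f' - w') - (2 * I * a * κ) • gm := by rw [ef, ew]; module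
  rw [ha, h7, inner_sub_right, inner_smul_right, h6, hmm]
  ring

end Extension


/-! ### Scalar spectral measures by Riesz-Markov -/

section SpectralMeasure

variable {H : Type*} [NormedAddCommGroup H] [InnerProductSpace ℂ H] [CompleteSpace H]

/-- A real continuous function on a compact space, as a complex one. -/
def complexify {X : Type*} [TopologicalSpace X] (f : C(X, ℝ)) : C(X, ℂ) :=
  ⟨fun x => (f x : ℂ), by fun_prop⟩

theorem inner_cfcHom_complexify_im {a : H →L[ℂ] H} (ha : IsStarNormal a) (g : H)
    (f : C(spectrum ℂ a, ℝ)) : (⟪g, cfcHom ha (complexify f) g⟫_ℂ).im = 0 := by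
  have h1 : star (complexify f) = complexify f := by ext x; simp [complexify]
  have h2 : star (cfcHom ha (complexify f)) = cfcHom ha (complexify f) := by
    rw [← map_star, h1]
  rw [← Complex.conj_eq_iff_im, inner_conj_symm]
  nth_rewrite 1 [← h2]
  rw [ContinuousLinearMap.star_eq_adjoint, ContinuousLinearMap.adjoint_inner_left]

theorem inner_cfcHom_complexify_nonneg {a : H →L[ℂ] H} (ha : IsStarNormal a) (g : H)
    {f : C(spectrum ℂ a, ℝ)} (hf : ∀ x, 0 ≤ f x) :
    0 ≤ (⟪g, cfcHom ha (complexify f) g⟫_ℂ).re := by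
  -- With `f = s̄ s`, the quadratic form becomes the square of a norm.
  let s : C(spectrum ℂ a, ℝ) := ⟨fun x => √(f x), by fun_prop⟩
  have h0 : complexify f = star (complexify s) * complexify s := by
    ext x
    simp only [complexify, s, ContinuousMap.coe_mk, ContinuousMap.mul_apply,
      ContinuousMap.star_apply, RCLike.star_def, conj_ofReal]
    rw [← ofReal_mul, Real.mul_self_sqrt (hf x)]
  rw [h0, map_mul, map_star, mul_apply_eq_comp, ContinuousLinearMap.star_eq_adjoint,
    ContinuousLinearMap.adjoint_inner_right, inner_self_eq_norm_sq_to_K]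
  simp only [coe_algebraMap, ← ofReal_pow, ofReal_re]
  positivity

/-- The scalar spectral measure of a bounded normal operator. -/
theorem exists_spectralMeasure {a : H →L[ℂ] H} (ha : IsStarNormal a) (g : H) :
    ∃ σ : Measure (spectrum ℂ a), IsFiniteMeasure σ ∧
      ∀ f : C(spectrum ℂ a, ℂ), ∫ w, f w ∂σ = ⟪g, cfcHom ha f g⟫_ℂ := by
  let L : C_c(spectrum ℂ a, ℝ) →ₗ[ℝ] ℝ :=
    { toFun := fun f => (⟪g, cfcHom ha (complexify f.toContinuousMap) g⟫_ℂ).re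
      map_add' := fun f₁ f₂ => by
        have : complexify (f₁ + f₂).toContinuousMap
            = complexify f₁.toContinuousMap + complexify f₂.toContinuousMap := by
          ext x; simp [complexify]
        rw [this, map_add, add_apply, inner_add_right, add_re]
      map_smul' := fun c f => by
        have : complexify (c • f).toContinuousMap
            = (c : ℂ) • complexify f.toContinuousMap := by
          ext x; simp [complexify]
        rw [this, map_smul, smul_apply, inner_smul_right, re_ofReal_mul]
        rfl }
  let Λ : C_c(spectrum ℂ a, ℝ) →ₚ[ℝ] ℝ := PositiveLinearMap.mk₀ L fun f hf =>
    inner_cfcHom_complexify_nonneg ha g fun x => hf x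
  let σ := RealRMK.rieszMeasure Λ
  have hfin : IsFiniteMeasure σ := inferInstance
  have hreal : ∀ f : C(spectrum ℂ a, ℝ),
      ((∫ w, f w ∂σ : ℝ) : ℂ) = ⟪g, cfcHom ha (complexify f) g⟫_ℂ := fun f => by
    have h := RealRMK.integral_rieszMeasure Λ (CompactlySupportedContinuousMap.continuousMapEquiv f)
    refine Complex.ext ?_ ?_
    · exact h
    · rw [inner_cfcHom_complexify_im, ofReal_im]
  refine ⟨σ, hfin, fun f => ?_⟩
  let fr : C(spectrum ℂ a, ℝ) := ⟨fun x => (f x).re, by fun_prop⟩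
  let fi : C(spectrum ℂ a, ℝ) := ⟨fun x => (f x).im, by fun_prop⟩
  have hf : f = complexify fr + I • complexify fi := by
    ext x
    simp [complexify, fr, fi, mul_comm I]
  have hint : Integrable f σ := by
    refine Integrable.of_bound (C := ‖f‖) f.continuous.aestronglyMeasurable ?_
    exact Eventually.of_forall fun x => f.norm_coe_le_norm x
  have h1 := integral_re_add_im hint
  have h2 := hreal fr
  have h3 := hreal fi
  rw [← h1]
  nth_rewrite 3 [hf]
  rw [map_add, map_smul, add_apply, smul_apply,
    inner_add_right, inner_smul_right, ← h2, ← h3, mul_comm I]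
  rfl

end SpectralMeasure

/-! ### The Cayley transform and M as an integral over its spectrum -/

section CayleyTransform

variable {H : Type*} [NormedAddCommGroup H] [InnerProductSpace ℂ H]

/-- The Cayley transform `(A - i I)(A + i I)⁻¹`. -/
noncomputable def cayley (A : H →ₗ.[ℂ] H) : H →L[ℂ] H := 1 - (2 * I) • res A (-I)

/-- The function `(z t + 1)/(t - z)` in the variable `w = (t - i)/(t + i)`. -/
noncomputable def cayleyKernel (z w : ℂ) : ℂ :=
  (z * (I * (1 + w)) + (1 - w)) / (I * (1 + w) - z * (1 - w))

theorem ofReal_re_cayley_inv {w : ℂ} (hw : ‖w‖ = 1) (hw1 : w ≠ 1) :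
    ((I * (1 + w) / (1 - w)).re : ℂ) * (1 - w) = I * (1 + w) := by
  have h1 : (1 - w) ≠ 0 := sub_ne_zero.2 hw1.symm
  have hww : w * conj w = 1 := by rw [mul_conj, normSq_eq_norm_sq, hw]; simp
  have hw0 : w ≠ 0 := by rintro rfl; simp at hw
  have hc : conj w = w⁻¹ := eq_inv_of_mul_eq_one_right hww
  have h3 : w - 1 ≠ 0 := sub_ne_zero.2 hw1
  have h2 : conj (I * (1 + w) / (1 - w)) = I * (1 + w) / (1 - w) := by
    simp only [map_div₀, map_mul, map_add, map_sub, conj_I, map_one, hc]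
    have h4 : 1 - w⁻¹ ≠ 0 := by
      rw [sub_ne_zero]; intro h; exact hw1 (inv_eq_one.1 h.symm)
    field_simp
    ring
  rw [conj_eq_iff_re.1 h2, div_mul_cancel₀ _ h1]

/-- With `1 - w` cleared, the kernel is continuous on the whole circle, including `w = 1`, which
stands for `t = ∞`. -/
theorem cayleyKernel_denom_ne_zero {z w : ℂ} (hz : z.im ≠ 0) (hw : ‖w‖ = 1) :
    I * (1 + w) - z * (1 - w) ≠ 0 := by
  by_cases hw1 : w = 1
  · subst hw1; simp
  · rw [← ofReal_re_cayley_inv hw hw1, ← sub_mul]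
    refine mul_ne_zero ?_ (sub_ne_zero.2 (Ne.symm hw1))
    intro h
    have := congrArg Complex.im h
    simp at this
    exact hz this

theorem cayleyKernel_eq {z w : ℂ} (hw : ‖w‖ = 1) (hw1 : w ≠ 1) {t : ℝ}
    (ht : t = (I * (1 + w) / (1 - w)).re) : cayleyKernel z w = (z * t + 1) / (t - z) := by
  have h := ofReal_re_cayley_inv hw hw1
  rw [← ht] at h
  rw [cayleyKernel, ← h]
  have h1 : (1 - w) ≠ 0 := sub_ne_zero.2 hw1.symm
  rw [← mul_div_mul_right (z * t + 1) (t - z) h1]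
  congr 1 <;> ring

variable [CompleteSpace H] {A : H →ₗ.[ℂ] H}

theorem adjoint_res (hA : IsSelfAdjoint A) {z : ℂ} (hz : z ∈ rho A) :
    (res A z).adjoint = res A (conj z) := by
  refine ContinuousLinearMap.ext fun x => ext_inner_left ℂ fun v => ?_
  rw [ContinuousLinearMap.adjoint_inner_right, inner_res_left hA hz]

theorem cayley_mem_unitary (hA : IsSelfAdjoint A) : cayley A ∈ unitary (H →L[ℂ] H) := by
  have hm : -I ∈ rho A := mem_rho_of_im_ne_zero hA (by simp)
  have hp : I ∈ rho A := mem_rho_of_im_ne_zero hA (by simp)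
  have hs : star (cayley A) = 1 + (2 * I) • res A I := by
    rw [cayley, star_sub, star_one, star_smul, ContinuousLinearMap.star_eq_adjoint,
      adjoint_res hA hm]
    simp
  have h1 : ∀ x, (2 * I) • res A I (res A (-I) x) = res A I x - res A (-I) x := fun x => by
    rw [← neg_sub, res_sub_res hm hp x]
    module
  have h2 : ∀ x, (2 * I) • res A (-I) (res A I x) = res A I x - res A (-I) x := fun x => by
    rw [res_sub_res hp hm x]
    module
  rw [Unitary.mem_iff, hs, cayley]
  constructor
  · refine ContinuousLinearMap.ext fun x => ?_
    simp only [mul_apply_eq_comp, add_apply, sub_apply, smul_apply, one_apply_eq_self, map_sub,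
      map_smul, h1]
    module
  · refine ContinuousLinearMap.ext fun x => ?_
    simp only [mul_apply_eq_comp, add_apply, sub_apply, smul_apply, one_apply_eq_self, map_add,
      map_smul, h2]
    module

theorem norm_of_mem_spectrum_cayley (hA : IsSelfAdjoint A) {w : ℂ}
    (hw : w ∈ spectrum ℂ (cayley A)) : ‖w‖ = 1 := by
  exact mem_sphere_zero_iff_norm.1
    (spectrum.subset_circle_of_unitary (E := H →L[ℂ] H) (cayley_mem_unitary hA) hw)

/-- The Weyl-Titchmarsh function as an integral over the spectrum of the Cayley transform. -/
theorem exists_measure_cayley (hA : IsSelfAdjoint A) (gp : H) :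
    ∃ σ : Measure (spectrum ℂ (cayley A)), IsFiniteMeasure σ ∧ σ.real Set.univ = ‖gp‖ ^ 2 ∧
      ∀ z : ℂ, z.im ≠ 0 → Integrable (fun w : spectrum ℂ (cayley A) => cayleyKernel z w) σ ∧
        weylTitchmarsh A gp z = ∫ w : spectrum ℂ (cayley A), cayleyKernel z w ∂σ := by
  have ha : IsStarNormal (cayley A) :=
    ⟨(Unitary.mem_iff.1 (cayley_mem_unitary hA)).1.trans
      (Unitary.mem_iff.1 (cayley_mem_unitary hA)).2.symm⟩
  obtain ⟨σ, hσ, hint⟩ := exists_spectralMeasure ha gp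
  refine ⟨σ, hσ, ?_, fun z hz => ?_⟩
  · have h := hint 1
    simp only [ContinuousMap.one_apply, integral_const, map_one, one_apply_eq_self,
      inner_self_eq_norm_sq_to_K] at h
    have h' := congrArg Complex.re h
    simpa [← ofReal_pow] using h'
  · have hden : ∀ w : spectrum ℂ (cayley A), I * (1 + (w : ℂ)) - z * (1 - (w : ℂ)) ≠ 0 := fun w =>
      cayleyKernel_denom_ne_zero hz (norm_of_mem_spectrum_cayley hA w.2)
    let i : C(spectrum ℂ (cayley A), ℂ) := (ContinuousMap.id ℂ).restrict (spectrum ℂ (cayley A))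
    let f : C(spectrum ℂ (cayley A), ℂ) := ⟨fun w => cayleyKernel z w, by
      unfold cayleyKernel
      exact Continuous.div (by fun_prop) (by fun_prop) hden⟩
    have hfD : f * (I • (1 + i) - z • (1 - i)) = (z * I) • (1 + i) + (1 - i) := by
      ext w
      simp only [f, i, cayleyKernel, ContinuousMap.mul_apply, ContinuousMap.coe_mk,
        ContinuousMap.sub_apply, ContinuousMap.smul_apply, ContinuousMap.add_apply,
        ContinuousMap.one_apply, ContinuousMap.restrict_apply, ContinuousMap.id_apply, smul_eq_mul]
      rw [div_mul_cancel₀ _ (hden w)]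
      ring
    have hi : cfcHom ha i = cayley A := cfcHom_id ha
    have hzA : z ∈ rho A := mem_rho_of_im_ne_zero hA hz
    have hm : -I ∈ rho A := mem_rho_of_im_ne_zero hA (by simp)
    have hx := res_mem_graph hzA gp
    set x := res A z gp
    have hRv := res_of_mem_graph hm hx
    -- Here `v = (A + i)x`, so the Cayley transform `U` satisfies `(1 - U)v = 2i x` and `(1 + U)v =
    -- 2Ax`. On `v` the denominator of the kernel acts as `2i(A - z)x = 2i g₊` and the numerator as
    -- `2i(zA + 1)x`.
    set v := gp + z • x - -I • x with hv
    have hUv : cayley A v = v - (2 * I) • x := by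
      simp [cayley, hRv]
    have h1 := DFunLike.congr_fun (congrArg (cfcHom ha) hfD) v
    rw [map_mul, mul_apply_eq_comp] at h1
    have e1 : cfcHom ha (I • (1 + i) - z • (1 - i)) v = (2 * I) • gp := by
      simp only [map_sub, map_add, map_smul, map_one, hi, sub_apply, smul_apply, add_apply,
        one_apply_eq_self, hUv]
      rw [hv]
      module
    have e2 : cfcHom ha ((z * I) • (1 + i) + (1 - i)) v = (2 * I) • (z • (gp + z • x) + x) := by
      simp only [map_sub, map_add, map_smul, map_one, hi, sub_apply, smul_apply, add_apply,
        one_apply_eq_self, hUv]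
      rw [hv]
      module
    have h2 : cfcHom ha f gp = z • (gp + z • x) + x := by
      rw [e1, e2, map_smul] at h1
      exact smul_right_injective H (by simp : (2 * I : ℂ) ≠ 0) h1
    refine ⟨?_, ?_⟩
    · refine Integrable.of_bound (C := ‖f‖) f.continuous.aestronglyMeasurable ?_
      exact Eventually.of_forall fun w => f.norm_coe_le_norm w
    · rw [weylTitchmarsh, app_of_mem_graph hx, ← h2]
      exact (hint f).symm

end CayleyTransform


/-! ### Behaviour of g_{iy} as y → ∞ -/

section Asymptotics

variable {H : Type*} [NormedAddCommGroup H] [InnerProductSpace ℂ H] [CompleteSpace H]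
  {A : H →ₗ.[ℂ] H}

theorem abs_im_mul_norm_res_le (hA : IsSelfAdjoint A) {z : ℂ} (hz : z ∈ rho A) (h : H) :
    |z.im| * ‖res A z h‖ ≤ ‖h‖ := by
  simpa using abs_im_mul_norm_le hA (res_mem_graph hz h) z

/-- With `x = R(iy)h`, compare `‖(A - i)x‖² = ‖Ax‖² + ‖x‖²` with `‖h‖² = ‖Ax‖² + y²‖x‖²`. This
uniform bound reduces the limit of `g_{iy}` to vectors in `Dom A`. -/
theorem norm_deficiencyField_le (hA : IsSelfAdjoint A) {y : ℝ} (hy : 1 ≤ y) (h : H) :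
    ‖deficiencyField A h (y * I)‖ ≤ ‖h‖ := by
  have hz : (y * I : ℂ) ∈ rho A := mem_rho_of_im_ne_zero hA (by simp; positivity)
  have hx := res_mem_graph hz h
  have h1 := norm_sub_smul_sq hA hx (y * I)
  have h2 := norm_sub_smul_sq hA hx I
  have e1 : h + (y * I : ℂ) • res A (y * I) h - (y * I : ℂ) • res A (y * I) h = h := by abel
  have e2 : h + (y * I : ℂ) • res A (y * I) h - I • res A (y * I) h
      = deficiencyField A h (y * I) := by rw [deficiencyField]; module
  rw [e1] at h1
  rw [e2] at h2
  simp only [mul_re, ofReal_re, I_re, ofReal_im, I_im, mul_zero, sub_zero, ofReal_zero,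
    zero_smul, mul_im, mul_one, add_zero] at h1 h2
  refine abs_le_of_sq_le_sq' ?_ (norm_nonneg _) |>.2
  rw [h1, h2]
  have : 1 ^ 2 ≤ y ^ 2 := by gcongr
  gcongr

theorem norm_deficiencyField_le_of_mem_graph (hA : IsSelfAdjoint A) {y : ℝ} (hy : 1 ≤ y) {h k : H}
    (hk : (h, k) ∈ A.graph) : ‖deficiencyField A h (y * I)‖ ≤ (‖k‖ + ‖h‖) / y := by
  have hy0 : 0 < y := by positivity
  have hz : (y * I : ℂ) ∈ rho A := mem_rho_of_im_ne_zero hA (by simp; positivity)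
  have h1 := res_of_mem_graph hz hk
  rw [map_sub, map_smul] at h1
  have e : deficiencyField A h (y * I) = res A (y * I) k - I • res A (y * I) h := by
    rw [deficiencyField]
    nth_rewrite 1 [← h1]
    module
  have hb : ∀ v, ‖res A (y * I) v‖ ≤ ‖v‖ / y := fun v => by
    rw [le_div_iff₀' hy0]
    simpa [abs_of_pos hy0] using abs_im_mul_norm_res_le hA hz v
  rw [e, add_div]
  refine (norm_sub_le _ _).trans (add_le_add (hb k) ?_)
  rw [norm_smul, norm_I, one_mul]
  exact hb h

theorem tendsto_deficiencyField (hA : IsSelfAdjoint A) (gp : H) :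
    Tendsto (fun y : ℝ => deficiencyField A gp (y * I)) atTop (𝓝 0) := by
  rw [Metric.tendsto_nhds]
  intro ε hε
  obtain ⟨h, hd, hh⟩ := Metric.dense_iff.1 hA.dense_domain gp (ε / 2) (half_pos hε)
  have hlim : Tendsto (fun y : ℝ => (‖A ⟨h, hh⟩‖ + ‖h‖) / y) atTop (𝓝 0) :=
    tendsto_const_nhds.div_atTop tendsto_id
  filter_upwards [eventually_ge_atTop 1, hlim.eventually_lt_const (half_pos hε)] with y hy hy'
  have e : deficiencyField A gp (y * I)
      = deficiencyField A (gp - h) (y * I) + deficiencyField A h (y * I) := by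
    simp only [deficiencyField, map_sub]
    module
  rw [dist_zero_right, e]
  have h1 := norm_deficiencyField_le hA hy (gp - h)
  have h2 := norm_deficiencyField_le_of_mem_graph hA hy (A.mem_graph ⟨h, hh⟩)
  have h3 : ‖gp - h‖ < ε / 2 := by
    rw [← dist_eq_norm, dist_comm]; exact hd
  calc _ ≤ _ := norm_add_le _ _
    _ < ε := by linarith

/-- If `y g_{iy}` stays bounded, then `g_i` lies in the domain of `A`. -/
theorem mem_domain_of_bounded (hA : IsSelfAdjoint A) {gp : H} {C : ℝ}
    (hC : ∀ y : ℝ, 1 ≤ y → y * ‖deficiencyField A gp (y * I)‖ ≤ C) : gp ∈ A.domain := by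
  -- These vectors lie in `Dom A`, tend to `g₊`, and have bounded images under `A`; hence `x ↦ (Ax,
  -- g₊)` is bounded and `g₊ ∈ Dom A* = Dom A`.
  let k : ℝ → H := fun y => gp - deficiencyField A gp (y * I)
  have hk : Tendsto k atTop (𝓝 gp) := by
    simpa using tendsto_const_nhds.sub (tendsto_deficiencyField hA gp)
  have hkg : ∀ y : ℝ, 1 ≤ y →
      (k y, -(y * I : ℂ) • deficiencyField A gp (y * I) + I • gp) ∈ A.graph := fun y hy => by
    have hz : (y * I : ℂ) ∈ rho A := mem_rho_of_im_ne_zero hA (by simp; positivity)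
    have h := A.graph.smul_mem (-(y * I - I : ℂ)) (res_mem_graph hz gp)
    convert h using 1
    ext
    · simp only [k, deficiencyField, Prod.smul_mk]
      module
    · simp only [Prod.smul_mk, deficiencyField]
      module
  have hbound : ∀ x : A.domain, ‖⟪gp, A x⟫_ℂ‖ ≤ (C + ‖gp‖) * ‖(x : H)‖ := fun x => by
    have hl : Tendsto (fun y => ‖⟪k y, A x⟫_ℂ‖) atTop (𝓝 ‖⟪gp, A x⟫_ℂ‖) :=
      (hk.inner tendsto_const_nhds).norm
    refine le_of_tendsto hl ?_
    filter_upwards [eventually_ge_atTop 1] with y hy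
    rw [← inner_graph hA (hkg y hy) (A.mem_graph x)]
    refine (norm_inner_le_norm _ _).trans ?_
    gcongr
    refine (norm_add_le _ _).trans ?_
    rw [norm_smul, norm_smul, norm_neg, norm_mul, norm_I, mul_one, one_mul, norm_real,
      Real.norm_of_nonneg (by positivity)]
    linarith [hC y hy]
  have hd : gp ∈ A†.domain := by
    rw [LinearPMap.mem_adjoint_domain_iff]
    exact AddMonoidHomClass.continuous_of_bound ((innerₛₗ ℂ gp).comp A.toFun) _ hbound
  rwa [LinearPMap.isSelfAdjoint_def.1 hA] at hd

end Asymptotics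

/-! ### Herglotz integrals and the norm of g_z -/

section Herglotz

theorem one_add_sq_le {z : ℂ} (hz : z.im ≠ 0) (t : ℝ) :
    1 + t ^ 2 ≤ (2 + (2 * ‖z‖ ^ 2 + 1) / z.im ^ 2) * ‖(t : ℂ) - z‖ ^ 2 := by
  have h1 : z.im ^ 2 ≤ ‖(t : ℂ) - z‖ ^ 2 := by
    have := Complex.abs_im_le_norm ((t : ℂ) - z)
    rw [← sq_abs]
    simp only [sub_im, ofReal_im, zero_sub, abs_neg] at this
    gcongr
  have h2 : t ^ 2 ≤ 2 * ‖(t : ℂ) - z‖ ^ 2 + 2 * ‖z‖ ^ 2 := by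
    have h3 : |t| ≤ ‖(t : ℂ) - z‖ + ‖z‖ := by
      calc |t| = ‖((t : ℂ) - z) + z‖ := by simp
        _ ≤ _ := norm_add_le _ _
    rw [← sq_abs]
    nlinarith [sq_nonneg (‖(t : ℂ) - z‖ - ‖z‖), abs_nonneg t]
  have hpos : 0 < z.im ^ 2 := by positivity
  have h4 : 2 * ‖z‖ ^ 2 + 1 ≤ (2 * ‖z‖ ^ 2 + 1) / z.im ^ 2 * ‖(t : ℂ) - z‖ ^ 2 := by
    rw [div_mul_eq_mul_div, le_div_iff₀ hpos]
    gcongr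
  linarith

theorem ofReal_sub_ne_zero {z : ℂ} (hz : z.im ≠ 0) (t : ℝ) : (t : ℂ) - z ≠ 0 := by
  intro h
  have := congrArg Complex.im h
  simp at this
  exact hz this

theorem one_add_ofReal_sq_ne_zero (t : ℝ) : 1 + (t : ℂ) ^ 2 ≠ 0 := by
  have : (0 : ℝ) < 1 + t ^ 2 := by positivity
  exact_mod_cast this.ne'

/-- Splits off the weight `1/(1 + t²)` from a factor bounded in `t`, so that the normalization of
`μ` gives integrability. -/
theorem herglotzKernel_eq {z : ℂ} (hz : z.im ≠ 0) (t : ℝ) :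
    1 / ((t : ℂ) - z) - (t : ℂ) / (1 + (t : ℂ) ^ 2)
      = (z + (1 + z ^ 2) / ((t : ℂ) - z)) * (((1 + t ^ 2)⁻¹ : ℝ) : ℂ) := by
  have h1 := ofReal_sub_ne_zero hz t
  have h2 := one_add_ofReal_sq_ne_zero t
  push_cast
  field_simp
  ring

theorem im_herglotzKernel (z : ℂ) (t : ℝ) :
    (1 / ((t : ℂ) - z) - (t : ℂ) / (1 + (t : ℂ) ^ 2)).im = z.im * (‖(t : ℂ) - z‖ ^ 2)⁻¹ := by
  have h : (t : ℂ) / (1 + (t : ℂ) ^ 2) = ((t / (1 + t ^ 2) : ℝ) : ℂ) := by push_cast; rfl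
  rw [sub_im, h, ofReal_im, sub_zero, one_div, inv_im, ← normSq_eq_norm_sq]
  simp [div_eq_mul_inv]

variable {μ : Measure ℝ}

theorem integrable_one_add_sq_inv
    (hμ : ∫⁻ t : ℝ, (ENNReal.ofReal (1 + t ^ 2))⁻¹ ∂μ = 1) :
    Integrable (fun t : ℝ => (1 + t ^ 2)⁻¹) μ := by
  refine ⟨by fun_prop, ?_⟩
  rw [hasFiniteIntegral_iff_enorm]
  have : ∀ t : ℝ, ‖(1 + t ^ 2)⁻¹‖ₑ = (ENNReal.ofReal (1 + t ^ 2))⁻¹ := fun t => by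
    rw [Real.enorm_eq_ofReal (by positivity), ENNReal.ofReal_inv_of_pos (by positivity)]
  simp only [this, hμ]
  exact ENNReal.one_lt_top

theorem integrable_herglotzKernel (hμ : ∫⁻ t : ℝ, (ENNReal.ofReal (1 + t ^ 2))⁻¹ ∂μ = 1) {z : ℂ}
    (hz : z.im ≠ 0) :
    Integrable (fun t : ℝ => 1 / ((t : ℂ) - z) - (t : ℂ) / (1 + (t : ℂ) ^ 2)) μ := by
  refine ((integrable_one_add_sq_inv hμ).const_mul (‖z‖ + ‖1 + z ^ 2‖ / |z.im|)).mono'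
    (by fun_prop) (Eventually.of_forall fun t => ?_)
  rw [herglotzKernel_eq hz, norm_mul, norm_real, Real.norm_of_nonneg (by positivity)]
  gcongr
  refine (norm_add_le _ _).trans ?_
  rw [norm_div]
  have := Complex.abs_im_le_norm ((t : ℂ) - z)
  simp only [sub_im, ofReal_im, zero_sub, abs_neg] at this
  have := abs_pos.2 hz
  gcongr

theorem im_integral_herglotzKernel (hμ : ∫⁻ t : ℝ, (ENNReal.ofReal (1 + t ^ 2))⁻¹ ∂μ = 1) {z : ℂ}
    (hz : z.im ≠ 0) :
    (∫ t : ℝ, (1 / ((t : ℂ) - z) - (t : ℂ) / (1 + (t : ℂ) ^ 2)) ∂μ).im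
      = z.im * ∫ t : ℝ, (‖(t : ℂ) - z‖ ^ 2)⁻¹ ∂μ := by
  have h := integral_im (integrable_herglotzKernel hμ hz)
  rw [← integral_const_mul]
  simp only [← im_herglotzKernel z]
  exact h.symm

theorem lintegral_eq_ofReal (hμ : ∫⁻ t : ℝ, (ENNReal.ofReal (1 + t ^ 2))⁻¹ ∂μ = 1) {z : ℂ}
    (hz : z.im ≠ 0) :
    ∫⁻ t : ℝ, (‖(t : ℂ) - z‖ₑ ^ 2)⁻¹ ∂μ = ENNReal.ofReal (∫ t : ℝ, (‖(t : ℂ) - z‖ ^ 2)⁻¹ ∂μ) := by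
  have hint : Integrable (fun t : ℝ => (‖(t : ℂ) - z‖ ^ 2)⁻¹) μ := by
    refine ((integrable_one_add_sq_inv hμ).const_mul
      (2 + (2 * ‖z‖ ^ 2 + 1) / z.im ^ 2)).mono' (by fun_prop) (Eventually.of_forall fun t => ?_)
    have h1 := one_add_sq_le hz t
    have h2 : 0 < ‖(t : ℂ) - z‖ ^ 2 := by
      have := norm_pos_iff.2 (ofReal_sub_ne_zero hz t); positivity
    rw [Real.norm_of_nonneg (by positivity), ← div_eq_mul_inv, le_div_iff₀ (by positivity),
      inv_mul_le_iff₀ h2]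
    linarith
  rw [ofReal_integral_eq_lintegral_ofReal hint (Eventually.of_forall fun t => by positivity)]
  refine lintegral_congr fun t => ?_
  have h2 := norm_pos_iff.2 (ofReal_sub_ne_zero hz t)
  rw [ENNReal.ofReal_inv_of_pos (by positivity), ENNReal.ofReal_pow (norm_nonneg _), ofReal_norm]

variable {H : Type*} [NormedAddCommGroup H] [InnerProductSpace ℂ H] [CompleteSpace H]
  {A : H →ₗ.[ℂ] H} {gp : H}

/-- Infinite mass is not assumed, since `measure_univ_eq_top` derives it from this formula. -/
theorem enorm_sq_deficiencyField_of_im_pos (hA : IsSelfAdjoint A) (hgp1 : ‖gp‖ = 1)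
    (hμ : ∫⁻ t : ℝ, (ENNReal.ofReal (1 + t ^ 2))⁻¹ ∂μ = 1)
    (hM : ∀ z : ℂ, 0 < z.im → weylTitchmarsh A gp z
      = ∫ t : ℝ, (1 / ((t : ℂ) - z) - (t : ℂ) / (1 + (t : ℂ) ^ 2)) ∂μ)
    {z : ℂ} (hz : 0 < z.im) :
    ‖deficiencyField A gp z‖ₑ ^ 2 = ∫⁻ t : ℝ, (‖(t : ℂ) - z‖ₑ ^ 2)⁻¹ ∂μ := by
  have h1 := im_weylTitchmarsh hA hgp1 (mem_rho_of_im_ne_zero hA hz.ne')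
  rw [hM z hz, im_integral_herglotzKernel hμ hz.ne'] at h1
  rw [lintegral_eq_ofReal hμ hz.ne', mul_left_cancel₀ hz.ne' h1,
    ENNReal.ofReal_pow (norm_nonneg _), ofReal_norm]

/-- Since `|t - iy| ≥ y`, one has `y²‖g_{iy}‖² ≤ μ(ℝ)`, and a finite bound would put `g₊` in `Dom
A`. -/
theorem measure_univ_eq_top (hA : IsSelfAdjoint A) (hgp1 : ‖gp‖ = 1) (hgpA : gp ∉ A.domain)
    (hμ : ∫⁻ t : ℝ, (ENNReal.ofReal (1 + t ^ 2))⁻¹ ∂μ = 1)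
    (hM : ∀ z : ℂ, 0 < z.im → weylTitchmarsh A gp z
      = ∫ t : ℝ, (1 / ((t : ℂ) - z) - (t : ℂ) / (1 + (t : ℂ) ^ 2)) ∂μ) :
    μ Set.univ = ∞ := by
  by_contra hne
  refine hgpA (mem_domain_of_bounded hA (C := √(μ Set.univ).toReal) fun y hy => ?_)
  have hy0 : 0 < y := by positivity
  have h1 := enorm_sq_deficiencyField_of_im_pos hA hgp1 hμ hM (z := y * I) (by simpa using hy0)
  refine Real.le_sqrt_of_sq_le ?_
  rw [mul_pow]
  have h2 : ∫⁻ t : ℝ, (‖(t : ℂ) - y * I‖ₑ ^ 2)⁻¹ ∂μ ≤ ENNReal.ofReal ((y ^ 2)⁻¹) * μ Set.univ := by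
    rw [← lintegral_const]
    refine lintegral_mono fun t => ?_
    rw [ENNReal.ofReal_inv_of_pos (by positivity), ENNReal.inv_le_inv, ← ofReal_norm,
      ← ENNReal.ofReal_pow (norm_nonneg _)]
    refine ENNReal.ofReal_le_ofReal ?_
    have := Complex.abs_im_le_norm ((t : ℂ) - y * I)
    simp only [sub_im, ofReal_im, mul_im, ofReal_re, I_im, I_re, mul_one, mul_zero, add_zero,
      zero_sub, abs_neg, abs_of_pos hy0] at this
    gcongr
  rw [← h1, ← ofReal_norm, ← ENNReal.ofReal_pow (norm_nonneg _), ← ENNReal.ofReal_toReal hne,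
    ← ENNReal.ofReal_mul (by positivity), ENNReal.ofReal_le_ofReal_iff (by positivity)] at h2
  rw [inv_mul_eq_div, le_div_iff₀ (by positivity)] at h2
  linarith

theorem enorm_sq_deficiencyField (hA : IsSelfAdjoint A) (hgp1 : ‖gp‖ = 1)
    (hμ : IsHerglotzNevanlinna (weylTitchmarsh A gp) μ) {z : ℂ} (hz : z ∈ rho A) :
    ‖deficiencyField A gp z‖ₑ ^ 2 = ∫⁻ t : ℝ, (‖(t : ℂ) - z‖ₑ ^ 2)⁻¹ ∂μ := by
  have hpos : ∀ {z : ℂ}, 0 < z.im →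
      ‖deficiencyField A gp z‖ₑ ^ 2 = ∫⁻ t : ℝ, (‖(t : ℂ) - z‖ₑ ^ 2)⁻¹ ∂μ :=
    enorm_sq_deficiencyField_of_im_pos hA hgp1 hμ.normalized hμ.represents
  rcases lt_trichotomy z.im 0 with hneg | hzero | hp
  · have h1 := hpos (z := conj z) (by simpa using hneg)
    have h2 := im_weylTitchmarsh hA hgp1 hz
    have h3 := im_weylTitchmarsh hA hgp1 (conj_mem_rho hA hz)
    rw [weylTitchmarsh_conj hA hgp1 hz, conj_im, h2, conj_im, neg_mul, neg_inj] at h3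
    have h4 := mul_left_cancel₀ hneg.ne h3
    have h5 : ‖deficiencyField A gp z‖ₑ = ‖deficiencyField A gp (conj z)‖ₑ := by
      rw [← ofReal_norm, ← ofReal_norm,
        (pow_left_inj₀ (norm_nonneg _) (norm_nonneg _) two_ne_zero).1 h4]
    rw [h5, h1]
    refine lintegral_congr fun t => ?_
    have : (t : ℂ) - conj z = conj ((t : ℂ) - z) := by simp
    rw [this, ← ofReal_norm, ← ofReal_norm, Complex.norm_conj]
  -- Real points of `ρ(A)` are approached vertically: `|t - z - iε|⁻²` increases as `ε` decreases,
  -- so monotone convergence meets the continuity of `g_z`.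
  · let ε : ℕ → ℝ := fun n => 1 / ((n : ℝ) + 1)
    have hε : ∀ n, 0 < ε n := fun n => by positivity
    have hε0 : Tendsto ε atTop (𝓝 0) := tendsto_one_div_add_atTop_nhds_zero_nat
    have hεanti : Antitone ε := fun m n h => by
      have : (m : ℝ) ≤ n := by exact_mod_cast h
      simp only [ε]
      gcongr
    have hzn : Tendsto (fun n => z + ε n * I) atTop (𝓝 z) := by
      have h : Tendsto (fun n => z + (ε n : ℂ) * I) atTop (𝓝 (z + ((0 : ℝ) : ℂ) * I)) :=
        tendsto_const_nhds.add (((continuous_ofReal.tendsto 0).comp hε0).mul_const I)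
      simpa using h
    have hl : Tendsto (fun n => ‖deficiencyField A gp (z + ε n * I)‖ₑ ^ 2) atTop
        (𝓝 (‖deficiencyField A gp z‖ₑ ^ 2)) := by
      have hc := (analyticOnNhd_deficiencyField A gp z hz).continuousAt
      exact ENNReal.Tendsto.pow ((continuous_enorm.tendsto _).comp (hc.tendsto.comp hzn))
    have heq : ∀ n, ‖deficiencyField A gp (z + ε n * I)‖ₑ ^ 2
        = ∫⁻ t : ℝ, (‖(t : ℂ) - (z + ε n * I)‖ₑ ^ 2)⁻¹ ∂μ := fun n =>
      hpos (by simpa [hzero] using hε n)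
    simp only [heq] at hl
    refine tendsto_nhds_unique hl ?_
    refine lintegral_tendsto_of_tendsto_of_monotone (fun n => by fun_prop) ?_ ?_
    · refine Eventually.of_forall fun t m n hmn => ?_
      simp only
      rw [ENNReal.inv_le_inv, ← ofReal_norm, ← ofReal_norm, ← ENNReal.ofReal_pow (norm_nonneg _),
        ← ENNReal.ofReal_pow (norm_nonneg _)]
      refine ENNReal.ofReal_le_ofReal ?_
      rw [← normSq_eq_norm_sq, ← normSq_eq_norm_sq, normSq_apply, normSq_apply]
      have h1 := hεanti hmn
      have h2 := hε n
      simp [hzero]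
      nlinarith
    · refine Eventually.of_forall fun t => ?_
      refine tendsto_inv_iff.2 (ENNReal.Tendsto.pow ?_)
      exact (continuous_enorm.tendsto _).comp (tendsto_const_nhds.sub hzn)
  · exact hpos hp

end Herglotz


/-! ### Existence of the representing measure -/

section Existence

variable {H : Type*} [NormedAddCommGroup H] [InnerProductSpace ℂ H] [CompleteSpace H]
  {A : H →ₗ.[ℂ] H} {gp : H}

theorem cayleyKernel_one (z : ℂ) : cayleyKernel z 1 = z := by
  rw [cayleyKernel, sub_self, mul_zero, sub_zero, add_zero, mul_div_assoc, div_self, mul_one]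
  simp

theorem im_cayleyKernel_nonneg {z w : ℂ} (hz : 0 < z.im) (hw : ‖w‖ = 1) :
    0 ≤ (cayleyKernel z w).im := by
  by_cases hw1 : w = 1
  · subst hw1
    rw [cayleyKernel_one]
    exact hz.le
  · rw [cayleyKernel_eq hw hw1 rfl]
    set t := (I * (1 + w) / (1 - w)).re
    rw [div_im, ← sub_div]
    refine div_nonneg ?_ (normSq_nonneg _)
    simp
    nlinarith [sq_nonneg t]

/-- The kernel equals `z` at `w = 1` and has nonnegative imaginary part elsewhere, so `y σ{1} ≤ Im
M(iy) = y‖g_{iy}‖²`, and `g_{iy} → 0`. -/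
theorem ae_ne_one_of_cayley (hA : IsSelfAdjoint A) (hgp1 : ‖gp‖ = 1)
    {σ : Measure (spectrum ℂ (cayley A))} [IsFiniteMeasure σ]
    (hσ : ∀ z : ℂ, z.im ≠ 0 → Integrable (fun w : spectrum ℂ (cayley A) => cayleyKernel z w) σ ∧
      weylTitchmarsh A gp z = ∫ w : spectrum ℂ (cayley A), cayleyKernel z w ∂σ) :
    ∀ᵐ w : spectrum ℂ (cayley A) ∂σ, (w : ℂ) ≠ 1 := by
  set S : Set (spectrum ℂ (cayley A)) := {w | (w : ℂ) = 1} with hS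
  have hSm : MeasurableSet S := measurableSet_eq_fun measurable_subtype_coe measurable_const
  have hle : ∀ y : ℝ, 1 ≤ y → σ.real S ≤ ‖deficiencyField A gp (y * I)‖ ^ 2 := fun y hy => by
    have hy0 : 0 < y := by positivity
    have him : 0 < (y * I : ℂ).im := by simpa using hy0
    obtain ⟨hi, he⟩ := hσ (y * I) him.ne'
    have h1 := im_weylTitchmarsh hA hgp1 (mem_rho_of_im_ne_zero hA him.ne')
    rw [he] at h1
    have h2 : ∫ w : spectrum ℂ (cayley A), (cayleyKernel (y * I) w).im ∂σ
        = (∫ w : spectrum ℂ (cayley A), cayleyKernel (y * I) w ∂σ).im := integral_im hi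
    have h3 : ∫ w, S.indicator (fun _ => y) w ∂σ
        ≤ ∫ w : spectrum ℂ (cayley A), (cayleyKernel (y * I) w).im ∂σ := by
      refine integral_mono ((integrable_const y).indicator hSm) hi.im fun w => ?_
      by_cases hw : w ∈ S
      · rw [Set.indicator_of_mem hw]
        have : (w : ℂ) = 1 := hw
        simp only [this, cayleyKernel_one]
        simp
      · rw [Set.indicator_of_notMem hw]
        exact im_cayleyKernel_nonneg him (norm_of_mem_spectrum_cayley hA w.2)
    rw [integral_indicator_const _ hSm, h2, h1, smul_eq_mul] at h3
    simp only [mul_im, ofReal_re, I_im, mul_one, ofReal_im, I_re, mul_zero, add_zero] at h3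
    rw [mul_comm] at h3
    exact le_of_mul_le_mul_left h3 hy0
  have hlim : Tendsto (fun y : ℝ => ‖deficiencyField A gp (y * I)‖ ^ 2) atTop (𝓝 0) := by
    simpa using (tendsto_deficiencyField hA gp).norm.pow 2
  have h0 : σ.real S ≤ 0 :=
    ge_of_tendsto hlim ((eventually_ge_atTop 1).mono hle)
  have h1 : σ S = 0 := by
    have := le_antisymm h0 measureReal_nonneg
    rwa [measureReal_eq_zero_iff] at this
  rw [ae_iff]
  simpa [hS] using h1

theorem exists_isHerglotzNevanlinna (hA : IsSelfAdjoint A) (hgp1 : ‖gp‖ = 1)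
    (hgpA : gp ∉ A.domain) : ∃ μ : Measure ℝ, IsHerglotzNevanlinna (weylTitchmarsh A gp) μ := by
  obtain ⟨σ, hfin, hmass, hσ⟩ := exists_measure_cayley hA gp
  have hone := ae_ne_one_of_cayley hA hgp1 hσ
  -- The inverse Cayley map; at `w = 1` division by zero gives the value 0, harmless because that
  -- point is `σ`-null.
  let τ : spectrum ℂ (cayley A) → ℝ := fun w => (I * (1 + (w : ℂ)) / (1 - w)).re
  have hτ : Measurable τ := by fun_prop
  let d : spectrum ℂ (cayley A) → NNReal := fun w => (1 + τ w ^ 2).toNNReal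
  have hd : Measurable d := by fun_prop
  have hdr : ∀ w, (d w : ℝ) = 1 + τ w ^ 2 := fun w => Real.coe_toNNReal _ (by positivity)
  let μ : Measure ℝ := (σ.withDensity fun w => (d w : ℝ≥0∞)).map τ
  have hnorm : ∫⁻ t : ℝ, (ENNReal.ofReal (1 + t ^ 2))⁻¹ ∂μ = 1 := by
    rw [lintegral_map (by fun_prop) hτ,
      lintegral_withDensity_eq_lintegral_mul _ (by fun_prop) (by fun_prop)]
    have h1 : ∀ w, ((fun w => (d w : ℝ≥0∞)) * fun w => (ENNReal.ofReal (1 + τ w ^ 2))⁻¹) w = 1 := by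
      intro w
      refine ENNReal.mul_inv_cancel ?_ ENNReal.ofReal_ne_top
      have : (0 : ℝ) < 1 + τ w ^ 2 := by positivity
      simpa [d] using this
    simp only [h1, lintegral_one]
    rw [← ENNReal.toReal_eq_one_iff]
    simpa [hgp1, Measure.real] using hmass
  have hrep : ∀ z : ℂ, 0 < z.im → weylTitchmarsh A gp z
      = ∫ t : ℝ, (1 / ((t : ℂ) - z) - (t : ℂ) / (1 + (t : ℂ) ^ 2)) ∂μ := fun z hz => by
    rw [(hσ z hz.ne').2, integral_map hτ.aemeasurable (by fun_prop),
      integral_withDensity_eq_integral_smul hd]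
    refine integral_congr_ae ?_
    filter_upwards [hone] with w hw
    rw [cayleyKernel_eq (norm_of_mem_spectrum_cayley hA w.2) hw rfl, NNReal.smul_def, hdr,
      Complex.real_smul]
    have h1 := ofReal_sub_ne_zero hz.ne' (τ w)
    have h2 := one_add_ofReal_sq_ne_zero (τ w)
    change (z * (τ w : ℂ) + 1) / ((τ w : ℂ) - z) = _
    push_cast
    field_simp
    ring
  exact ⟨μ, measure_univ_eq_top hA hgp1 hgpA hnorm hrep, hnorm, hrep⟩

end Existence

/-! ### The Livšic function and Krein's formula -/

section KreinFormula

variable {H : Type*} [NormedAddCommGroup H] [InnerProductSpace ℂ H] [CompleteSpace H]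
  {Adot A Ahat : H →ₗ.[ℂ] H} {gp gm : H}

theorem livsic_eq_livsicQuotient (hA : IsSelfAdjoint A) (hle : A.graph ≤ Adot†.graph)
    (hdim : Module.finrank ℂ (deficiencySubspace Adot I) = 1)
    (hgp : gp ∈ deficiencySubspace Adot I) (hgp0 : gp ≠ 0) {z : ℂ} (hz : z ∈ rho A) {u : H}
    (hu : u ∈ deficiencySubspace Adot z) (hu0 : u ≠ 0) :
    livsic Adot gp gm z = livsicQuotient gp gm z u := by
  have key : ∀ v, v ∈ deficiencySubspace Adot z ∧ v ≠ 0 →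
      livsicQuotient gp gm z v = livsicQuotient gp gm z (deficiencyField A gp z) := by
    rintro v ⟨hv, hv0⟩
    obtain ⟨c, rfl⟩ := exists_eq_smul_deficiencyField hA hle hdim hgp hgp0 hz hv
    exact livsicQuotient_smul (left_ne_zero_of_smul hv0) gp gm z _
  rw [livsic, key _ (Classical.epsilon_spec (p := fun v : H =>
    v ∈ deficiencySubspace Adot z ∧ v ≠ 0) ⟨u, hu, hu0⟩), key u ⟨hu, hu0⟩]

/-- Krein's formula in the form `(M(z) + i (κ + 1)/(κ - 1)) c = -(h, g_{z̄})`, where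
`c g_z` is the difference of the resolvents at `h`. -/
theorem exists_res_eq_add_smul (hA : IsSelfAdjoint A) (hle : A.graph ≤ Adot†.graph)
    (hlehat : Ahat.graph ≤ Adot†.graph) (hdiss : IsDissipative Ahat)
    (hdim : Module.finrank ℂ (deficiencySubspace Adot I) = 1)
    (hgp : gp ∈ deficiencySubspace Adot I) (hgm : gm ∈ deficiencySubspace Adot (-I))
    (hgp1 : ‖gp‖ = 1) (hgm1 : ‖gm‖ = 1)
    (hg : (gp - gm, I • gp + I • gm) ∈ A.graph)
    {κ : ℂ} (hκ : κ ≠ 1) (hgAhat : gp - κ • gm ∈ Ahat.domain) {z : ℂ} (hzhat : z ∈ rho Ahat)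
    (hz : z ∈ rho A) (h : H) :
    ∃ c : ℂ, res Ahat z h = res A z h + c • deficiencyField A gp z ∧
      (weylTitchmarsh A gp z + I * ((κ + 1) / (κ - 1))) * c
        = -⟪deficiencyField A gp (conj z), h⟫_ℂ := by
  have hgp0 : gp ≠ 0 := by rintro rfl; simp at hgp1
  have hf := res_mem_graph hzhat h
  have hx := res_mem_graph hz h
  have hd : res Ahat z h - res A z h ∈ deficiencySubspace Adot z := by
    rw [mem_deficiencySubspace_iff]
    have := sub_mem (hlehat hf) (hle hx)
    convert this using 1
    simp only [Prod.mk_sub_mk]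
    congr 1
    module
  obtain ⟨c, hc⟩ := exists_eq_smul_deficiencyField hA hle hdim hgp hgp0 hz hd
  have hc' : res Ahat z h = res A z h + c • deficiencyField A gp z := by rw [← hc]; abel
  refine ⟨c, hc', ?_⟩
  -- The boundary condition at `(Â - z)⁻¹h` is linear in `c`; `hP` and `hQ` evaluate the coefficient
  -- through `M`, and `hT`, symmetry of `A` between `g₊ - g₋` and `R(z)h`, eliminates `g₋` from the
  -- rest.
  have hbc := boundary_condition hA hle hlehat hdiss hdim hgp hgm hgp1 hgm1 hg hgAhat hf
  have hP := add_I_mul_inner_deficiencyField hgp1 hz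
  have hQ := sub_I_mul_inner_deficiencyField hA hgp1 hg hz
  have hT := inner_graph hA hg hx
  have hR : ⟪deficiencyField A gp (conj z), h⟫_ℂ
      = ⟪gp, h⟫_ℂ + (z + I) * ⟪gp, res A z h⟫_ℂ := by
    rw [deficiencyField, inner_add_left, inner_smul_left, inner_res_left hA (conj_mem_rho hA hz)]
    simp
  rw [hc'] at hbc
  simp only [inner_sub_right, inner_add_right, inner_smul_right, inner_add_left, inner_sub_left,
    inner_smul_left, conj_I] at hbc hT
  have hκ' : κ - 1 ≠ 0 := sub_ne_zero.2 hκ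
  rw [hR]
  field_simp
  linear_combination hbc - κ * c * hP + c * hQ + hT

/-- Quotient of the two pairing identities. As `M + i = (z + i)(g_z, g₊)`, the condition `hM`
excludes exactly the poles listed in the theorem. -/
theorem livsic_eq_div (hA : IsSelfAdjoint A) (hle : A.graph ≤ Adot†.graph)
    (hdim : Module.finrank ℂ (deficiencySubspace Adot I) = 1)
    (hgp : gp ∈ deficiencySubspace Adot I) (hgp1 : ‖gp‖ = 1)
    (hg : (gp - gm, I • gp + I • gm) ∈ A.graph) {z : ℂ} (hz : z ∈ rho A)
    (hM : weylTitchmarsh A gp z + I ≠ 0) :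
    livsic Adot gp gm z
      = (weylTitchmarsh A gp z - I) / (weylTitchmarsh A gp z + I) := by
  have hgp0 : gp ≠ 0 := by rintro rfl; simp at hgp1
  have hP := add_I_mul_inner_deficiencyField hgp1 hz
  have hQ := sub_I_mul_inner_deficiencyField hA hgp1 hg hz
  rw [livsic_eq_livsicQuotient hA hle hdim hgp hgp0 hz (deficiencyField_mem hle hgp hz)
    (deficiencyField_ne_zero (notMem_domain hA hle hgp hgp0) hz), livsicQuotient, div_mul_div_comm,
    hP, hQ]

end KreinFormula

end KreinResolvent

/-! ### The theorem -/

open KreinResolvent in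
theorem mainTheorem7 {H : Type*} [NormedAddCommGroup H] [InnerProductSpace ℂ H] [CompleteSpace H]
    (Adot A Ahat : H →ₗ.[ℂ] H) (gp gm : H) (κ : ℂ)
    -- `Adot` is a densely defined symmetric operator with deficiency indices `(1, 1)`
    (hdense : Dense (Adot.domain : Set H))
    (hsymm : IsSymmetric Adot)
    (hdef : HasDeficiencyIndicesOneOne Adot)
    -- `A` is a self-adjoint extension
    (hA : IsSelfAdjoint A) (hAext : Adot ≤ A)
    -- `Ahat` is a maximal dissipative extension that is not self-adjoint
    (hAhat : IsMaximalDissipative Ahat) (hAhatext : Adot ≤ Ahat) (hne : Ahat ≠ Ahat†)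
    -- normalized deficiency elements and the von Neumann parameter
    (hgp : gp ∈ deficiencySubspace Adot I) (hgm : gm ∈ deficiencySubspace Adot (-I))
    (hgp1 : ‖gp‖ = 1) (hgm1 : ‖gm‖ = 1)
    (hgA : gp - gm ∈ A.domain)
    (hκ : ‖κ‖ < 1) (hgAhat : gp - κ • gm ∈ Ahat.domain) :
    -- the Weyl-Titchmarsh function obeys the Schwarz reflection principle
    (∀ z ∈ rho A, conj z ∈ rho A ∧
      weylTitchmarsh A gp (conj z) = conj (weylTitchmarsh A gp z)) ∧
    -- the representing measure exists
    (∃ μ : Measure ℝ, IsHerglotzNevanlinna (weylTitchmarsh A gp) μ) ∧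
    -- the Livšic function does not depend on the choice of the deficiency elements
    (∀ z ∈ rho A, ∀ u ∈ deficiencySubspace Adot z, u ≠ 0 →
      livsic Adot gp gm z = livsicQuotient gp gm z u ∧ (0 < z.im → ⟪gp, u⟫_ℂ ≠ 0)) ∧
    ∃ g : ℂ → H,
      -- deficiency elements, analytic in `z`, normalized, extending the given ones
      (∀ z ∈ rho A, g z ∈ deficiencySubspace Adot z ∧ g z ≠ 0) ∧
      AnalyticOnNhd ℂ g (rho A) ∧
      g I = gp ∧ g (-I) = gm ∧
      (∀ μ : Measure ℝ, IsHerglotzNevanlinna (weylTitchmarsh A gp) μ → ∀ z ∈ rho A,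
        ‖g z‖ₑ = (∫⁻ t : ℝ, (‖(t : ℂ) - z‖ₑ ^ 2)⁻¹ ∂μ) ^ (1 / 2 : ℝ)) ∧
      ∀ z ∈ rho Ahat ∩ rho A,
        -- the resolvent formula, with `p` given by the Weyl-Titchmarsh function
        weylTitchmarsh A gp z + I * ((κ + 1) / (κ - 1)) ≠ 0 ∧
        (∀ h : H, res Ahat z h = res A z h - (kreinP A gp κ z * ⟪g (conj z), h⟫_ℂ) • g z) ∧
        -- `p` in terms of the Livšic function, at finite values of the latter
        (z ≠ -I ∧ ⟪gp, g z⟫_ℂ ≠ 0 →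
          livsic Adot gp gm z ≠ 1 ∧
          kreinP A gp κ z =
            I * ((livsic Adot gp gm z + 1) / (livsic Adot gp gm z - 1)
              - (κ + 1) / (κ - 1))⁻¹) ∧
        -- and at its poles, where `(s + 1)/(s - 1)` takes the value `1`
        (z = -I ∨ ⟪gp, g z⟫_ℂ = 0 →
          kreinP A gp κ z = I * (1 - (κ + 1) / (κ - 1))⁻¹) := by
  have hgp0 : gp ≠ 0 := by rintro rfl; simp at hgp1
  have hle := graph_le_graph_adjoint hdense hA hAext
  have hlehat := graph_le_graph_adjoint_of_isDissipative hdense hsymm hAhat.1 hAhatext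
  have hgpA := notMem_domain hA hle hgp hgp0
  have hκ1 : κ ≠ 1 := by rintro rfl; simp at hκ
  -- `A` acts as `Ȧ*`, which multiplies `g₊` by `i` and `g₋` by `-i`.
  have hg : (gp - gm, I • gp + I • gm) ∈ A.graph := by
    have h1 := A.mem_graph ⟨_, hgA⟩
    have h2 := sub_mem (mem_deficiencySubspace_iff.1 hgp) (mem_deficiencySubspace_iff.1 hgm)
    rw [LinearPMap.mem_graph_snd_inj _ (hle h1) h2 rfl] at h1
    convert h1 using 2
    simp
  refine ⟨fun z hz => ⟨conj_mem_rho hA hz, weylTitchmarsh_conj hA hgp1 hz⟩,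
    exists_isHerglotzNevanlinna hA hgp1 hgpA, fun z hz u hu hu0 =>
      ⟨livsic_eq_livsicQuotient hA hle hdef.1 hgp hgp0 hz hu hu0, fun him => ?_⟩,
    deficiencyField A gp, fun z hz => ⟨deficiencyField_mem hle hgp hz,
      deficiencyField_ne_zero hgpA hz⟩, analyticOnNhd_deficiencyField A gp,
    deficiencyField_I A gp, deficiencyField_neg_I hA hg, fun μ hμ z hz => ?_, ?_⟩
  · obtain ⟨c, rfl⟩ := exists_eq_smul_deficiencyField hA hle hdef.1 hgp hgp0 hz hu
    rw [inner_smul_right]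
    -- A zero pairing would give `M(z) = -i`, against `Im M(z) ≥ 0` in the upper half-plane.
    refine mul_ne_zero (left_ne_zero_of_smul hu0) fun h0 => ?_
    have h1 := add_I_mul_inner_deficiencyField hgp1 hz
    have h2 := im_weylTitchmarsh hA hgp1 hz
    rw [h0, mul_zero] at h1
    have h3 := congrArg Complex.im h1
    rw [zero_im, add_im, I_im, h2] at h3
    have : 0 ≤ z.im * ‖deficiencyField A gp z‖ ^ 2 := by positivity
    linarith
  · rw [← enorm_sq_deficiencyField hA hgp1 hμ hz, ← ENNReal.rpow_natCast, ← ENNReal.rpow_mul]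
    norm_num
  · rintro z ⟨hzhat, hz⟩
    have hkrein := exists_res_eq_add_smul hA hle hlehat hAhat.1 hdef.1 hgp hgm hgp1 hgm1 hg hκ1
      hgAhat hzhat hz
    have hne0 : weylTitchmarsh A gp z + I * ((κ + 1) / (κ - 1)) ≠ 0 := by
      intro h0
      -- For this `h` the right-hand side is `-‖g_{z̄}‖² ≠ 0`.
      obtain ⟨c, -, h1⟩ := hkrein (deficiencyField A gp (conj z))
      rw [h0, zero_mul, eq_comm, neg_eq_zero, inner_self_eq_zero] at h1
      exact deficiencyField_ne_zero hgpA (conj_mem_rho hA hz) h1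
    have hP := add_I_mul_inner_deficiencyField hgp1 hz
    refine ⟨hne0, fun h => ?_, ?_, ?_⟩
    · obtain ⟨c, h1, h2⟩ := hkrein h
      have : c = -(kreinP A gp κ z * ⟪deficiencyField A gp (conj z), h⟫_ℂ) := by
        rw [kreinP, ← mul_neg, ← h2, inv_mul_cancel_left₀ hne0]
      rw [h1, this, neg_smul, sub_eq_add_neg]
    · rintro ⟨hzI, hgz⟩
      have hM : weylTitchmarsh A gp z + I ≠ 0 := by
        rw [← hP]
        exact mul_ne_zero (fun h => hzI (eq_neg_of_add_eq_zero_left h)) hgz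
      have hs := livsic_eq_div hA hle hdef.1 hgp hgp1 hg hz hM
      have hs1 : livsic Adot gp gm z - 1 = -(2 * I) / (weylTitchmarsh A gp z + I) := by
        rw [hs]; field_simp; ring
      have hs2 : livsic Adot gp gm z + 1
          = 2 * weylTitchmarsh A gp z / (weylTitchmarsh A gp z + I) := by
        rw [hs]; field_simp; ring
      refine ⟨fun h => ?_, ?_⟩
      · rw [h, sub_self, eq_comm, div_eq_zero_iff] at hs1
        simp [hM] at hs1
      · have hq : (livsic Adot gp gm z + 1) / (livsic Adot gp gm z - 1)
            = I * weylTitchmarsh A gp z := by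
          rw [hs1, hs2, div_div_div_cancel_right₀ hM, div_eq_iff (by simp)]
          linear_combination 2 * weylTitchmarsh A gp z * I_sq
        have e : I * weylTitchmarsh A gp z - (κ + 1) / (κ - 1)
            = I * (weylTitchmarsh A gp z + I * ((κ + 1) / (κ - 1))) := by
          linear_combination -((κ + 1) / (κ - 1)) * I_sq
        rw [hq, e, mul_inv, mul_inv_cancel_left₀ I_ne_zero, kreinP]
    · intro hpole
      -- At a pole `iM = 1`, which is the prescribed value of `(s + 1)/(s - 1)`.
      have hM : weylTitchmarsh A gp z = -I := by
        refine eq_neg_of_add_eq_zero_left ?_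
        rw [← hP]
        rcases hpole with h | h
        · rw [h]; simp
        · rw [h, mul_zero]
      have e : -I + I * ((κ + 1) / (κ - 1)) = -I * (1 - (κ + 1) / (κ - 1)) := by ring
      rw [kreinP, hM, e, mul_inv, inv_neg, inv_I, neg_neg]
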